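/- **Notation.** Functions are complex-valued and measurable on $[0,1]$ with Lebesgue measure. $f^*$ is the non-increasing rearrangement of $|f|$ and $(c_k^*)_{k\ge 1}$ is the non-increasing rearrangement of $(|c_n|)_n$; $1/\infty=0$, and sums are replaced by suprema when an exponent is $\infty$. For $\alpha\in\mathbb R$ and $2\le q\le\infty$, let $L_{2,q}(\log L)_\alpha$ be the space of all $f$ with $$\|f\|_{L_{2,q}(\log L)_\alpha}=\Big\|t^{1/2-1/q}(1+|\log t|)^{\alpha}f^*(t)\Big\|_{L_q(0,1)}<\infty,\qquad L_{2,q}=L_{2,q}(\log L)_0,$$ and let $l^{\mathcal L}_{2,q,\alpha,2}$ be the space of all families $c=(c_n)$ with $$\|c\|_{l^{\mathcal L}_{2,q,\alpha,2}}=\Big(\sum_{k=1}^\infty\Big[k^{-1/q}(1+\log k)^{\alpha}\Big(\sum_{i=1}^k(c_i^*)^2\Big)^{1/2}\Big]^q\Big)^{1/q}<\infty .$$ Let $\{\varphi_n\}_{n\in I}$ ($I\neq\emptyset$ any index set, for instance $\mathbb N$ or $\mathbb Z$) be an orthonormal system in $L_2(0,1)$ with $\sup_n\|\varphi_n\|_{L_\infty}=M<\infty$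 (hence $M\ge1$), and put $\mathcal F(f)=(c_n(f))_{n\in I}$, $c_n(f)=\int_0^1 f(x)\overline{\varphi_n(x)}\,dx$. **Statement.** 1. Let $2\le q\le\infty$ and $\alpha<\tfrac12-\tfrac1q$. There is a constant $C>0$ depending only on $q$ and $\alpha$ such that, for every such system and every $f\in L_{2,q}(\log L)_\alpha$, the functions $f$ and $f\overline{\varphi_n}$ ($n \in I$) are integrable on $[0,1]$ and $$\|\mathcal F(f)\|_{l^{\mathcal L}_{2,q,\alpha-1/2,2}}\le C\,\min\big(M,(1+\log M)^{|\alpha-1/2|}\big)\,\|f\|_{L_{2,q}(\log L)_\alpha}.$$ 2. In particular, for $2<q\le\infty$ there is a constant $C>0$ depending only on $q$ such that, for every such system and every $f\in L_{2,q}$, $$\|\mathcal F(f)\|_{l^{\mathcal L}_{2,q,-1/2,2}}\le C\,(1+\log M)^{1/2}\,\|f\|_{L_{2,q}}.$$ 3. For $2<q\le\infty$ and $\alpha<\tfrac12-\tfrac1q$ there is a constant $C>0$ depending only on $q$ and $\alpha$ such that, for every family $c$ of complex numbers, $$\|c\|_{l^{\mathcal L}_{2,\infty,1/q-1/2+\alpha,2}}\le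 C\,\|c\|_{l^{\mathcal L}_{2,q,\alpha-1/2,2}}.$$ Thus 1 improves the estimate of $\mathcal F:L_{2,q}(\log L)_\alpha\to l^{\mathcal L}_{2,\infty,1/q-1/2+\alpha,2}$ with norm at most a constant times $M$, due to Bochkarev for $\alpha=0$ and to Oba, Sato and Sato in general. -/

import Mathlib

open MeasureTheory Set
open scoped ENNReal

noncomputable section

namespace LorentzFourier

/-- Lebesgue measure on `[0,1]`. -/
abbrev μI : Measure ℝ := volume.restrict (Icc (0 : ℝ) 1)

/-- The non-increasing rearrangement of `|f|` for a function `f` on `[0,1]`: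
`f^*(t) = inf {s ≥ 0 : |{x ∈ [0,1] : |f x| > s}| ≤ t}`. -/
def rearrangement (f : ℝ → ℂ) (t : ℝ) : ℝ≥0∞ :=
  sInf {s : ℝ≥0∞ | μI {x | s < ‖f x‖ₑ} ≤ ENNReal.ofReal t}

/-- The non-increasing rearrangement of `{|c_n|}`, used for `k = 1, 2, …`:
`c_k^* = inf {s ≥ 0 : #{n : |c_n| > s} < k}`. -/
def seqRearrangement {ι : Type*} (c : ι → ℂ) (k : ℕ) : ℝ≥0∞ :=
  sInf {s : ℝ≥0∞ | {n | s < ‖c n‖ₑ}.encard < (k : ℕ∞)}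

/-- The (quasi-)norm of the Lorentz–Zygmund space `L_{p,q}(log L)_α`:
the `L_q(0,1)` norm of `t^{1/p-1/q} (1+|log t|)^α f^*(t)`. Here `1/∞ = 0`. -/
def lorentzZygmundNorm (p q : ℝ≥0∞) (α : ℝ) (f : ℝ → ℂ) : ℝ≥0∞ :=
  eLpNorm (fun t : ℝ =>
      ENNReal.ofReal (t ^ (p⁻¹.toReal - q⁻¹.toReal) * (1 + |Real.log t|) ^ α) *
        rearrangement f t)
    q (volume.restrict (Ioo (0 : ℝ) 1))

/-- `f` belongs to the Lorentz–Zygmund space `L_{p,q}(log L)_α`. -/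
def MemLorentzZygmund (p q : ℝ≥0∞) (α : ℝ) (f : ℝ → ℂ) : Prop :=
  AEStronglyMeasurable f μI ∧ lorentzZygmundNorm p q α f < ∞

/-- The (quasi-)norm of `l^𝓛_{p,q,α,r}`: the `l_q` norm over `k ≥ 1` of
`k^{-1/q} (1+log k)^α ‖(i^{1/p-1/r} c_i^*)_{1 ≤ i ≤ k}‖_{l_r}`.
With respect to counting measure `eLpNorm` is the `l_q` norm (a supremum for `q = ∞`). -/
def seqLNorm {ι : Type*} (p q : ℝ≥0∞) (α : ℝ) (r : ℝ≥0∞) (c : ι → ℂ) : ℝ≥0∞ :=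
  eLpNorm (fun k : ℕ =>
      ENNReal.ofReal ((k : ℝ) ^ (-q⁻¹.toReal) * (1 + Real.log k) ^ α) *
        eLpNorm (fun i : ℕ =>
            ENNReal.ofReal ((i : ℝ) ^ (p⁻¹.toReal - r⁻¹.toReal)) * seqRearrangement c i)
          r (Measure.count.restrict (Icc 1 k)))
    q (Measure.count.restrict (Ici 1))

/-- The Fourier coefficients of `f` with respect to the system `φ`:
`c_n(f) = ∫_0^1 f(x) conj(φ_n(x)) dx`. -/
def coeffs {ι : Type*} (φ : ι → Lp ℂ 2 μI) (f : ℝ → ℂ) (n : ι) : ℂ :=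
  ∫ x, f x * starRingEnd ℂ (φ n x) ∂μI

/-- `φ` is an orthonormal system in `L_2(0,1)` which is bounded in `L_∞(0,1)`, with
`sup_n ‖φ_n‖_{L_∞} = M < ∞`. -/
def IsBoundedOrthonormal {ι : Type*} (φ : ι → Lp ℂ 2 μI) (M : ℝ) : Prop :=
  Orthonormal ℂ φ ∧ (⨆ n, eLpNorm (φ n) ∞ μI) = ENNReal.ofReal M

end LorentzFourier

end

namespace LorentzFourier
open scoped NNReal


/-! ### `ℓ^q` norms of `ℝ≥0∞`-valued sequences -/

lemma eLpNorm_count_of_ne_top {q : ℝ≥0∞} (h0 : q ≠ 0) (ht : q ≠ ∞) (F : ℕ → ℝ≥0∞) :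
    eLpNorm F q Measure.count = (∑' n, F n ^ q.toReal) ^ (1 / q.toReal) := by
  rw [eLpNorm_eq_lintegral_rpow_enorm_toReal h0 ht, lintegral_count]
  simp

lemma eLpNorm_count_top (F : ℕ → ℝ≥0∞) : eLpNorm F ∞ Measure.count = ⨆ n, F n := by
  simp

lemma eLpNorm_count_comp_add_le (q : ℝ≥0∞) (G : ℕ → ℝ≥0∞) (a : ℕ) :
    eLpNorm (fun m => G (m + a)) q Measure.count ≤ eLpNorm G q Measure.count := by
  rcases eq_or_ne q 0 with rfl | h0
  · simp
  rcases eq_or_ne q ∞ with rfl | ht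
  · rw [eLpNorm_count_top, eLpNorm_count_top]
    exact iSup_le fun m => le_iSup G (m + a)
  · rw [eLpNorm_count_of_ne_top h0 ht, eLpNorm_count_of_ne_top h0 ht]
    refine ENNReal.rpow_le_rpow ?_ (by positivity)
    exact ENNReal.tsum_comp_le_tsum_of_injective (add_left_injective a) (fun n => G n ^ q.toReal)

lemma eLpNorm_le_mul_of_le_mul {X : Type*} [MeasurableSpace X] {μ : Measure X} {q : ℝ≥0∞}
    {F G : X → ℝ≥0∞} {c : ℝ≥0} (h : ∀ n, F n ≤ c * G n) :
    eLpNorm F q μ ≤ c * eLpNorm G q μ :=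
  eLpNorm_le_mul_eLpNorm_of_ae_le_mul' (Filter.Eventually.of_forall h) q

lemma eLpNorm_rpow_half {X : Type*} [MeasurableSpace X] {μ : Measure X} (q : ℝ≥0∞)
    (F : X → ℝ≥0∞) :
    eLpNorm (fun x => F x ^ (1 / 2 : ℝ)) q μ = eLpNorm F (q / 2) μ ^ (1 / 2 : ℝ) := by
  have h := eLpNorm_enorm_rpow (p := q) (μ := μ) F (q := 1 / 2) (by norm_num)
  simp only [enorm_eq_self] at h
  rw [h]
  congr 2
  rw [ENNReal.ofReal_div_of_pos (by norm_num)]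
  simp [div_eq_mul_inv]

lemma eLpNorm_sq {X : Type*} [MeasurableSpace X] {μ : Measure X} (q : ℝ≥0∞)
    (F : X → ℝ≥0∞) :
    eLpNorm (fun x => F x ^ (2 : ℝ)) (q / 2) μ = eLpNorm F q μ ^ (2 : ℝ) := by
  have h := eLpNorm_enorm_rpow (p := q / 2) (μ := μ) F (q := 2) (by norm_num)
  simp only [enorm_eq_self] at h
  rw [h]
  congr 2
  simp only [ENNReal.ofReal_ofNat]
  exact ENNReal.div_mul_cancel (by simp) (by simp)

/-! ### A Schur test -/

lemma rpow_tsum_mul_le {s : ℝ} (hs : 1 ≤ s) (w f : ℕ → ℝ≥0∞) :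
    (∑' j, w j * f j) ^ s ≤ (∑' j, w j) ^ (s - 1) * ∑' j, w j * f j ^ s := by
  have h0 : 0 < s := by linarith
  have key : ∑' j, w j * f j ≤ (∑' j, w j) ^ (1 - s⁻¹) * (∑' j, w j * f j ^ s) ^ s⁻¹ := by
    rw [ENNReal.tsum_eq_iSup_sum]
    refine iSup_le fun F => (ENNReal.inner_le_weight_mul_Lp_of_nonneg F hs w f).trans ?_
    have : 0 ≤ 1 - s⁻¹ := by
      have := inv_le_one_of_one_le₀ hs
      linarith
    gcongr
    · exact ENNReal.sum_le_tsum F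
    · exact ENNReal.sum_le_tsum F
  calc (∑' j, w j * f j) ^ s
      ≤ ((∑' j, w j) ^ (1 - s⁻¹) * (∑' j, w j * f j ^ s) ^ s⁻¹) ^ s := by gcongr
    _ = _ := by
      rw [ENNReal.mul_rpow_of_nonneg _ _ h0.le, ← ENNReal.rpow_mul, ← ENNReal.rpow_mul,
        inv_mul_cancel₀ h0.ne', ENNReal.rpow_one]
      congr 2
      field_simp

lemma schur_tsum {s : ℝ} (hs : 1 ≤ s) (K : ℕ → ℕ → ℝ≥0∞) (h x : ℕ → ℝ≥0∞)
    (hpos : ∀ j, h j ≠ 0) (hfin : ∀ j, h j ≠ ∞) {A B : ℝ≥0∞}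
    (hA : ∀ n, ∑' j, K n j * h j ≤ A * h n)
    (hB : ∀ j, ∑' n, K n j * h n ^ (s - 1) ≤ B * h j ^ (s - 1)) :
    ∑' n, (∑' j, K n j * x j) ^ s ≤ A ^ (s - 1) * B * ∑' j, x j ^ s := by
  have h1 : 0 ≤ s - 1 := by linarith
  have hcancel : ∀ j, h j * (x j / h j) = x j := fun j =>
    ENNReal.mul_div_cancel (hpos j) (hfin j)
  calc ∑' n, (∑' j, K n j * x j) ^ s
      = ∑' n, (∑' j, (K n j * h j) * (x j / h j)) ^ s := by
        simp only [mul_assoc, hcancel]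
    _ ≤ ∑' n, (A * h n) ^ (s - 1) * ∑' j, (K n j * h j) * (x j / h j) ^ s := by
        refine ENNReal.tsum_le_tsum fun n => (rpow_tsum_mul_le hs _ _).trans ?_
        gcongr
        exact hA n
    _ = A ^ (s - 1) * ∑' j, (h j * (x j / h j) ^ s) * ∑' n, K n j * h n ^ (s - 1) := by
        simp only [← ENNReal.tsum_mul_left]
        rw [ENNReal.tsum_comm]
        refine tsum_congr fun j => tsum_congr fun n => ?_
        rw [ENNReal.mul_rpow_of_nonneg _ _ h1]
        ring
    _ ≤ A ^ (s - 1) * ∑' j, (h j * (x j / h j) ^ s) * (B * h j ^ (s - 1)) := by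
        gcongr with j
        exact hB j
    _ = A ^ (s - 1) * B * ∑' j, x j ^ s := by
        rw [mul_assoc, ← ENNReal.tsum_mul_left (a := B)]
        congr 1
        refine tsum_congr fun j => ?_
        conv_rhs => rw [← hcancel j, ENNReal.mul_rpow_of_nonneg _ _ (by linarith)]
        have : h j ^ s = h j * h j ^ (s - 1) := by
          conv_lhs => rw [show s = 1 + (s - 1) by ring,
            ENNReal.rpow_add _ _ (hpos j) (hfin j), ENNReal.rpow_one]
        rw [this]
        ring

/-- Schur's test on `ℓ^s`, `1 ≤ s < ∞`, in norm form. -/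
lemma eLpNorm_schur {s : ℝ≥0∞} (hs : 1 ≤ s) (hst : s ≠ ∞) (K : ℕ → ℕ → ℝ≥0∞)
    (h : ℕ → ℝ≥0∞)
    (hpos : ∀ j, h j ≠ 0) (hfin : ∀ j, h j ≠ ∞) {A B : ℝ≥0}
    (hA : ∀ n, ∑' j, K n j * h j ≤ A * h n)
    (hB : ∀ j, ∑' n, K n j * h n ^ (s.toReal - 1) ≤ B * h j ^ (s.toReal - 1)) :
    ∃ C : ℝ≥0, ∀ x : ℕ → ℝ≥0∞, eLpNorm (fun n => ∑' j, K n j * x j) s Measure.count ≤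
      C * eLpNorm x s Measure.count := by
  have hs0 : s ≠ 0 := (zero_lt_one.trans_le hs).ne'
  have hs1 : 1 ≤ s.toReal := by
    simpa using (ENNReal.toReal_le_toReal ENNReal.one_ne_top hst).2 hs
  have h1 : 0 ≤ s.toReal - 1 := by linarith
  refine ⟨(A ^ (s.toReal - 1) * B) ^ (1 / s.toReal), fun x => ?_⟩
  rw [eLpNorm_count_of_ne_top hs0 hst, eLpNorm_count_of_ne_top hs0 hst]
  calc _ ≤ ((A : ℝ≥0∞) ^ (s.toReal - 1) * B * ∑' j, x j ^ s.toReal) ^ (1 / s.toReal) := by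
        gcongr
        exact schur_tsum hs1 K h x hpos hfin hA hB
    _ = _ := by
        rw [ENNReal.mul_rpow_of_nonneg _ _ (by positivity),
          ENNReal.coe_rpow_of_nonneg _ (by positivity), ENNReal.coe_mul,
          ENNReal.coe_rpow_of_nonneg _ h1]

lemma eLpNorm_top_schur (K : ℕ → ℕ → ℝ≥0∞) {A : ℝ≥0} (hA : ∀ n, ∑' j, K n j ≤ A)
    (x : ℕ → ℝ≥0∞) :
    eLpNorm (fun n => ∑' j, K n j * x j) ∞ Measure.count ≤ A * eLpNorm x ∞ Measure.count := by
  rw [eLpNorm_count_top, eLpNorm_count_top]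
  refine iSup_le fun n => ?_
  calc ∑' j, K n j * x j ≤ ∑' j, K n j * ⨆ i, x i := by
        gcongr with j
        exact le_iSup x j
    _ = (∑' j, K n j) * ⨆ i, x i := ENNReal.tsum_mul_right
    _ ≤ _ := by gcongr; exact hA n

/-! ### Power sums -/

lemma one_sub_rpow_le {u z : ℝ} (hu : 0 < u) (hz : 0 ≤ z) (hz1 : z ≤ 1) :
    (1 - z) ^ u ≤ 1 - min u 1 * z := by
  rcases le_total 1 u with h | h
  · rw [min_eq_right h]
    calc (1 - z) ^ u ≤ (1 - z) ^ (1 : ℝ) :=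
          Real.rpow_le_rpow_of_exponent_ge' (by linarith) (by linarith) (by norm_num) h
      _ = _ := by simp
  · rw [min_eq_left h]
    have := rpow_one_add_le_one_add_mul_self (s := -z) (by linarith) hu.le h
    calc (1 - z) ^ u = (1 + -z) ^ u := by ring_nf
      _ ≤ 1 + u * -z := this
      _ = _ := by ring

lemma sum_range_rpow_neg_le {r : ℝ} (hr : r < 1) (n : ℕ) :
    ∑ j ∈ Finset.range n, (1 + j : ℝ) ^ (-r) ≤ (min (1 - r) 1)⁻¹ * (n : ℝ) ^ (1 - r) := by
  have hu : 0 < 1 - r := by linarith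
  have hc : 0 < min (1 - r) 1 := lt_min hu one_pos
  induction n with
  | zero => simp [Real.zero_rpow hu.ne']
  | succ n ih =>
    rw [Finset.sum_range_succ]
    have hx : (0 : ℝ) < 1 + n := by positivity
    have hz1 : (1 + n : ℝ)⁻¹ ≤ 1 := inv_le_one_of_one_le₀ (by simp)
    have h1 := one_sub_rpow_le hu (inv_nonneg.2 hx.le) hz1
    have h2 : (n : ℝ) ^ (1 - r) = (1 + n : ℝ) ^ (1 - r) * (1 - (1 + n : ℝ)⁻¹) ^ (1 - r) := by
      rw [← Real.mul_rpow hx.le (by linarith)]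
      congr 1
      field_simp
      ring
    have h3 : (1 + n : ℝ) ^ (-r) = (1 + n : ℝ) ^ (1 - r) * (1 + n : ℝ)⁻¹ := by
      rw [← Real.rpow_neg_one (1 + n : ℝ), ← Real.rpow_add hx]
      congr 1
      ring
    have h4 : (0 : ℝ) ≤ (1 + n : ℝ) ^ (1 - r) := by positivity
    have h5 : (min (1 - r) 1)⁻¹ * (n : ℝ) ^ (1 - r) ≤ (min (1 - r) 1)⁻¹ *
        ((1 + n : ℝ) ^ (1 - r) * (1 - min (1 - r) 1 * (1 + n : ℝ)⁻¹)) := by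
      rw [h2]; gcongr
    have h6 : (min (1 - r) 1)⁻¹ *
        ((1 + n : ℝ) ^ (1 - r) * (1 - min (1 - r) 1 * (1 + n : ℝ)⁻¹)) =
        (min (1 - r) 1)⁻¹ * (1 + n : ℝ) ^ (1 - r) - (1 + n : ℝ) ^ (1 - r) * (1 + n : ℝ)⁻¹ := by
      field_simp
    push_cast
    rw [add_comm (n : ℝ) 1]
    linarith

lemma sum_Ico_rpow_neg_le {p : ℝ} (hp : 1 < p) (j n : ℕ) (hjn : j ≤ n) :
    ∑ i ∈ Finset.Ico j n, (1 + i : ℝ) ^ (-p) ≤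
      2 * (min (p - 1) 1)⁻¹ * ((1 + j : ℝ) ^ (1 - p) - (1 + n : ℝ) ^ (1 - p)) := by
  have hu : 0 < p - 1 := by linarith
  have hc : 0 < min (p - 1) 1 := lt_min hu one_pos
  induction n, hjn using Nat.le_induction with
  | base => simp
  | succ n hn ih =>
    rw [Finset.sum_Ico_succ_top hn]
    have hx : (0 : ℝ) < 1 + n := by positivity
    have hx2 : (0 : ℝ) < 2 + n := by positivity
    have h1 := one_sub_rpow_le hu (inv_nonneg.2 hx2.le) (inv_le_one_of_one_le₀ (by linarith))
    have h2 : (2 + n : ℝ) ^ (1 - p) = (1 + n : ℝ) ^ (1 - p) * (1 - (2 + n : ℝ)⁻¹) ^ (p - 1) := by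
      have e : (1 - (2 + n : ℝ)⁻¹) = (1 + n) * (2 + n : ℝ)⁻¹ := by field_simp; ring
      rw [e, Real.mul_rpow hx.le (by positivity), ← mul_assoc, ← Real.rpow_add hx,
        Real.inv_rpow hx2.le, ← Real.rpow_neg hx2.le]
      simp
    have h3 : (1 + n : ℝ) ^ (-p) = (1 + n : ℝ) ^ (1 - p) * (1 + n : ℝ)⁻¹ := by
      rw [← Real.rpow_neg_one (1 + n : ℝ), ← Real.rpow_add hx]
      congr 1
      ring
    have h4 : (0 : ℝ) ≤ (1 + n : ℝ) ^ (1 - p) := by positivity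
    have h5 : (1 + n : ℝ)⁻¹ ≤ 2 * (2 + n : ℝ)⁻¹ := by
      rw [← div_eq_mul_inv, inv_eq_one_div, div_le_div_iff₀ hx hx2]
      linarith
    have h6 : (1 + n : ℝ) ^ (-p) ≤ 2 * (min (p - 1) 1)⁻¹ * ((1 + n : ℝ) ^ (1 - p)
        - (2 + n : ℝ) ^ (1 - p)) := by
      rw [h2, h3]
      calc (1 + n : ℝ) ^ (1 - p) * (1 + n : ℝ)⁻¹
          ≤ (1 + n : ℝ) ^ (1 - p) * (2 * (2 + n : ℝ)⁻¹) := by gcongr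
        _ = 2 * (min (p - 1) 1)⁻¹ * ((1 + n : ℝ) ^ (1 - p) *
              (1 - (1 - min (p - 1) 1 * (2 + n : ℝ)⁻¹))) := by field_simp; ring
        _ ≤ 2 * (min (p - 1) 1)⁻¹ * ((1 + n : ℝ) ^ (1 - p) *
              (1 - (1 - (2 + n : ℝ)⁻¹) ^ (p - 1))) := by gcongr
        _ = _ := by ring
    push_cast
    rw [show (1 + (n + 1) : ℝ) = 2 + n by ring]
    linarith

lemma tsum_ite_le_rpow_neg_le {p : ℝ} (hp : 1 < p) (j : ℕ) :
    ∑' n : ℕ, (if j ≤ n then ENNReal.ofReal ((1 + n : ℝ) ^ (-p)) else 0) ≤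
      ENNReal.ofReal (2 * (min (p - 1) 1)⁻¹ * (1 + j : ℝ) ^ (1 - p)) := by
  have hc : 0 < min (p - 1) 1 := lt_min (by linarith) one_pos
  rw [ENNReal.tsum_eq_iSup_nat]
  refine iSup_le fun n => ?_
  rw [← Finset.sum_filter]
  have hsub : (Finset.range n).filter (fun i => j ≤ i) ⊆ Finset.Ico j (max j n) := by
    intro i hi
    simp only [Finset.mem_filter, Finset.mem_range, Finset.mem_Ico] at hi ⊢
    omega
  refine (Finset.sum_le_sum_of_subset hsub).trans ?_
  rw [← ENNReal.ofReal_sum_of_nonneg (fun i _ => by positivity)]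
  refine ENNReal.ofReal_le_ofReal ((sum_Ico_rpow_neg_le hp j _ (le_max_left _ _)).trans ?_)
  gcongr
  have : (0 : ℝ) ≤ (1 + (max j n : ℕ) : ℝ) ^ (1 - p) := by positivity
  linarith


/-! ### Discrete Hardy inequalities with logarithmic weights -/

/-- The kernel `(1+n)^{2α-1} (1+j)^{-2α}`, `j ≤ n`. -/
noncomputable def hardyKernel (α : ℝ) (n j : ℕ) : ℝ≥0∞ :=
  if j ≤ n then ENNReal.ofReal ((1 + n : ℝ) ^ (2 * α - 1) * (1 + j : ℝ) ^ (-(2 * α))) else 0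

lemma tsum_hardyKernel_mul_le {α ε : ℝ} (hε : 2 * α + ε < 1) (n : ℕ) :
    ∑' j, hardyKernel α n j * ENNReal.ofReal ((1 + j : ℝ) ^ (-ε)) ≤
      ((min (1 - (2 * α + ε)) 1)⁻¹).toNNReal * ENNReal.ofReal ((1 + n : ℝ) ^ (-ε)) := by
  have hc : 0 < min (1 - (2 * α + ε)) 1 := lt_min (by linarith) one_pos
  have hx : ∀ j : ℕ, (0 : ℝ) < 1 + j := fun j => by positivity
  rw [tsum_eq_sum (s := Finset.range (n + 1)) (fun j hj => by
    have : ¬ j ≤ n := by simpa [Nat.lt_succ_iff] using hj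
    simp [hardyKernel, this])]
  have h1 : ∀ j ∈ Finset.range (n + 1),
      hardyKernel α n j * ENNReal.ofReal ((1 + j : ℝ) ^ (-ε)) =
      ENNReal.ofReal ((1 + n : ℝ) ^ (2 * α - 1) * (1 + j : ℝ) ^ (-(2 * α + ε))) := by
    intro j hj
    have : j ≤ n := by simpa [Nat.lt_succ_iff] using hj
    rw [hardyKernel, if_pos this, ← ENNReal.ofReal_mul (by positivity), mul_assoc,
      ← Real.rpow_add (hx j)]
    congr 3
    ring
  rw [Finset.sum_congr rfl h1, ← ENNReal.ofReal_sum_of_nonneg (fun _ _ => by positivity),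
    ← Finset.mul_sum, ← ENNReal.ofReal, ← ENNReal.ofReal_mul (by positivity)]
  refine ENNReal.ofReal_le_ofReal ?_
  have h2 := sum_range_rpow_neg_le hε (n + 1)
  calc _ ≤ (1 + n : ℝ) ^ (2 * α - 1) *
        ((min (1 - (2 * α + ε)) 1)⁻¹ * ((n + 1 : ℕ) : ℝ) ^ (1 - (2 * α + ε))) := by gcongr
    _ = (min (1 - (2 * α + ε)) 1)⁻¹ *
        ((1 + n : ℝ) ^ (2 * α - 1) * (1 + n : ℝ) ^ (1 - (2 * α + ε))) := by
      push_cast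
      rw [add_comm (n : ℝ) 1]
      ring
    _ = _ := by
      rw [← Real.rpow_add (hx n)]
      congr 2
      ring

lemma tsum_hardyKernel_mul_rpow_le {α ε s : ℝ} (hs : 0 ≤ s - 1) (hε : 2 * α < ε * (s - 1))
    (j : ℕ) :
    ∑' n, hardyKernel α n j * ENNReal.ofReal ((1 + n : ℝ) ^ (-ε)) ^ (s - 1) ≤
      (2 * (min (1 - 2 * α + ε * (s - 1) - 1) 1)⁻¹).toNNReal *
        ENNReal.ofReal ((1 + j : ℝ) ^ (-ε)) ^ (s - 1) := by
  have hc : 0 < min (1 - 2 * α + ε * (s - 1) - 1) 1 := lt_min (by linarith) one_pos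
  have hx : ∀ j : ℕ, (0 : ℝ) < 1 + j := fun j => by positivity
  have hp : 1 < 1 - 2 * α + ε * (s - 1) := by linarith
  have hpow : ∀ n : ℕ, ENNReal.ofReal ((1 + n : ℝ) ^ (-ε)) ^ (s - 1) =
      ENNReal.ofReal ((1 + n : ℝ) ^ (-(ε * (s - 1)))) := fun n => by
    rw [ENNReal.ofReal_rpow_of_nonneg (by positivity) hs, ← Real.rpow_mul (hx n).le, neg_mul]
  have h1 : ∀ n, hardyKernel α n j * ENNReal.ofReal ((1 + n : ℝ) ^ (-ε)) ^ (s - 1) =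
      ENNReal.ofReal ((1 + j : ℝ) ^ (-(2 * α))) *
      (if j ≤ n then ENNReal.ofReal ((1 + n : ℝ) ^ (-(1 - 2 * α + ε * (s - 1)))) else 0) := by
    intro n
    rw [hpow, hardyKernel]
    split_ifs with h
    · rw [← ENNReal.ofReal_mul (by positivity), ← ENNReal.ofReal_mul (by positivity)]
      congr 1
      rw [show -(1 - 2 * α + ε * (s - 1)) = (2 * α - 1) + -(ε * (s - 1)) by ring,
        Real.rpow_add (hx n)]
      ring
    · simp
  simp_rw [h1]
  rw [ENNReal.tsum_mul_left, hpow, ← ENNReal.ofReal]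
  calc _ ≤ ENNReal.ofReal ((1 + j : ℝ) ^ (-(2 * α))) * ENNReal.ofReal
        (2 * (min (1 - 2 * α + ε * (s - 1) - 1) 1)⁻¹ *
          (1 + j : ℝ) ^ (1 - (1 - 2 * α + ε * (s - 1)))) := by
        gcongr
        exact tsum_ite_le_rpow_neg_le hp j
    _ = _ := by
      rw [← ENNReal.ofReal_mul (by positivity), ← ENNReal.ofReal_mul (by positivity)]
      congr 1
      rw [show -(ε * (s - 1)) = -(2 * α) + (1 - (1 - 2 * α + ε * (s - 1))) by ring,
        Real.rpow_add (hx j)]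
      ring

lemma eLpNorm_hardyKernel_le {s : ℝ≥0∞} {α : ℝ} (hs : 1 ≤ s) (hα : 2 * α < 1 - s⁻¹.toReal) :
    ∃ C : ℝ≥0, ∀ x : ℕ → ℝ≥0∞, eLpNorm (fun n => ∑' j, hardyKernel α n j * x j) s
      Measure.count ≤ C * eLpNorm x s Measure.count := by
  rcases eq_or_ne s ∞ with rfl | hst
  · have h1 : 2 * α + 0 < 1 := by simpa using hα
    exact ⟨_, fun x => eLpNorm_top_schur _ (fun n => by
      simpa using tsum_hardyKernel_mul_le h1 n) x⟩
  · have hs1 : 1 ≤ s.toReal := by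
      simpa using (ENNReal.toReal_le_toReal ENNReal.one_ne_top hst).2 hs
    have hs0 : 0 < s.toReal := by linarith
    set σ := s.toReal
    rw [ENNReal.toReal_inv] at hα
    change 2 * α < 1 - σ⁻¹ at hα
    set D : ℝ := (1 - 2 * α) * (σ - 1) - 2 * α with hD
    have hD0 : 0 < D := by
      have : 2 * α * σ < (1 - σ⁻¹) * σ := by gcongr
      rw [sub_mul, inv_mul_cancel₀ hs0.ne'] at this
      rw [hD]
      linarith
    have hδ : 0 < D / σ := by positivity
    have hδ' : D / σ * σ = D := div_mul_cancel₀ _ hs0.ne'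
    have h1 : 2 * α + (1 - 2 * α - D / σ) < 1 := by linarith
    have h2 : 2 * α < (1 - 2 * α - D / σ) * (σ - 1) := by nlinarith
    have hx : ∀ j : ℕ, (0 : ℝ) < 1 + j := fun j => by positivity
    exact eLpNorm_schur hs hst (hardyKernel α)
      (fun j => ENNReal.ofReal ((1 + j : ℝ) ^ (-(1 - 2 * α - D / σ))))
      (fun j => by
        have := Real.rpow_pos_of_pos (hx j) (-(1 - 2 * α - D / σ))
        simpa using this) (fun j => ENNReal.ofReal_ne_top)
      (tsum_hardyKernel_mul_le h1) (tsum_hardyKernel_mul_rpow_le (by linarith) h2)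

lemma eLpNorm_hardy_sq_le {q : ℝ≥0∞} {α : ℝ} (hq : 2 ≤ q) (hα : α < 1 / 2 - q⁻¹.toReal) :
    ∃ C : ℝ≥0, ∀ b : ℕ → ℝ≥0∞,
      eLpNorm (fun n : ℕ => ENNReal.ofReal ((1 + n : ℝ) ^ (α - 1 / 2)) *
        (∑ j ∈ Finset.range (n + 1), b j ^ (2 : ℝ)) ^ (1 / 2 : ℝ)) q Measure.count ≤
      C * eLpNorm (fun j : ℕ => ENNReal.ofReal ((1 + j : ℝ) ^ α) * b j) q Measure.count := by
  have hs : 1 ≤ q / 2 := by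
    rw [ENNReal.le_div_iff_mul_le (by simp) (by simp)]
    simpa using hq
  have hα' : 2 * α < 1 - (q / 2)⁻¹.toReal := by
    have : (q / 2)⁻¹ = 2 * q⁻¹ := by
      rw [ENNReal.inv_div (by simp) (by simp), div_eq_mul_inv]
    rw [this, ENNReal.toReal_mul]
    simp only [ENNReal.toReal_ofNat]
    linarith
  obtain ⟨C, hC⟩ := eLpNorm_hardyKernel_le hs hα'
  have hx : ∀ j : ℕ, (0 : ℝ) < 1 + j := fun j => by positivity
  refine ⟨C ^ (1 / 2 : ℝ), fun b => ?_⟩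
  have h1 : (fun n : ℕ => ENNReal.ofReal ((1 + n : ℝ) ^ (α - 1 / 2)) *
        (∑ j ∈ Finset.range (n + 1), b j ^ (2 : ℝ)) ^ (1 / 2 : ℝ)) = fun n =>
      (∑' j, hardyKernel α n j * (ENNReal.ofReal ((1 + j : ℝ) ^ α) * b j) ^ (2 : ℝ)) ^
        (1 / 2 : ℝ) := by
    funext n
    have e1 : ∑' j, hardyKernel α n j * (ENNReal.ofReal ((1 + j : ℝ) ^ α) * b j) ^ (2 : ℝ) =
        ENNReal.ofReal ((1 + n : ℝ) ^ (2 * α - 1)) *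
          ∑ j ∈ Finset.range (n + 1), b j ^ (2 : ℝ) := by
      rw [tsum_eq_sum (s := Finset.range (n + 1)) (fun j hj => by
        have : ¬ j ≤ n := by simpa [Nat.lt_succ_iff] using hj
        simp [hardyKernel, this]), Finset.mul_sum]
      refine Finset.sum_congr rfl fun j hj => ?_
      have : j ≤ n := by simpa [Nat.lt_succ_iff] using hj
      rw [hardyKernel, if_pos this, ENNReal.mul_rpow_of_nonneg _ _ (by norm_num),
        ENNReal.ofReal_rpow_of_nonneg (by positivity) (by norm_num), ← mul_assoc,
        ← ENNReal.ofReal_mul (by positivity), mul_assoc, ← Real.rpow_mul (hx j).le,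
        ← Real.rpow_add (hx j)]
      rw [show -(2 * α) + α * 2 = 0 by ring]
      simp
    rw [e1, ENNReal.mul_rpow_of_nonneg _ _ (by norm_num),
      ENNReal.ofReal_rpow_of_nonneg (by positivity) (by norm_num), ← Real.rpow_mul (hx n).le]
    congr 3
    ring
  rw [h1, eLpNorm_rpow_half]
  calc _ ≤ ((C : ℝ≥0∞) * eLpNorm (fun j : ℕ =>
        (ENNReal.ofReal ((1 + j : ℝ) ^ α) * b j) ^ (2 : ℝ)) (q / 2) Measure.count) ^
          (1 / 2 : ℝ) := by
        gcongr
        exact hC _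
    _ = _ := by
        rw [eLpNorm_sq, ENNReal.mul_rpow_of_nonneg _ _ (by norm_num), ← ENNReal.rpow_mul,
          ENNReal.coe_rpow_of_nonneg _ (by norm_num)]
        simp

lemma summable_rpow_mul_two_rpow (a : ℝ) :
    Summable fun i : ℕ => (1 + i : ℝ) ^ a * (2 : ℝ) ^ (-(i : ℝ) / 2) := by
  obtain ⟨r, hr0, hr, e⟩ : ∃ r : ℝ, 0 < r ∧ r < 1 ∧
      ∀ i : ℕ, (2 : ℝ) ^ (-(i : ℝ) / 2) = r ^ i := by
    refine ⟨2 ^ (-(1 / 2) : ℝ), by positivity,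
      Real.rpow_lt_one_of_one_lt_of_neg (by norm_num) (by norm_num), fun i => ?_⟩
    rw [← Real.rpow_natCast, ← Real.rpow_mul (by norm_num)]
    congr 1
    ring
  have h0 : Summable fun n : ℕ => (n : ℝ) ^ ⌈a⌉₊ * r ^ n :=
    summable_pow_mul_geometric_of_norm_lt_one ⌈a⌉₊ (by rwa [Real.norm_of_nonneg hr0.le])
  have h : Summable fun i : ℕ => ((i + 1 : ℕ) : ℝ) ^ ⌈a⌉₊ * r ^ (i + 1) :=
    (summable_nat_add_iff (f := fun n : ℕ => (n : ℝ) ^ ⌈a⌉₊ * r ^ n) 1).2 h0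
  refine Summable.of_nonneg_of_le (fun i => by positivity) (fun i => ?_) (h.mul_left r⁻¹)
  have e2 : (1 + i : ℝ) ^ a ≤ ((i + 1 : ℕ) : ℝ) ^ ⌈a⌉₊ := by
    rw [← Real.rpow_natCast]
    push_cast
    rw [add_comm (i : ℝ) 1]
    exact Real.rpow_le_rpow_of_exponent_le (by simp) (Nat.le_ceil a)
  rw [e]
  calc _ ≤ ((i + 1 : ℕ) : ℝ) ^ ⌈a⌉₊ * r ^ i := by gcongr
    _ = _ := by
      rw [pow_succ r]
      field_simp

lemma tsum_ite_comp_le_of_injOn (P : ℕ → Prop) [DecidablePred P] (e : ℕ → ℕ) (g : ℕ → ℝ≥0∞)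
    (he : InjOn e {j | P j}) :
    ∑' j, (if P j then g (e j) else 0) ≤ ∑' i, g i := by
  have h1 : ∑' j, (if P j then g (e j) else 0) = ∑' x : {j | P j}, g (e x) := by
    rw [tsum_subtype {j | P j} (fun j => g (e j))]
    refine tsum_congr fun j => ?_
    simp [indicator_apply]
  rw [h1]
  exact ENNReal.tsum_comp_le_tsum_of_injective (injOn_iff_injective.1 he) g

lemma rpow_le_rpow_abs_mul {x y c : ℝ} (a : ℝ) (hx : 0 < x) (hy : 0 < y) (hc : 1 ≤ c)
    (h1 : x ≤ c * y) (h2 : y ≤ c * x) : x ^ a ≤ c ^ |a| * y ^ a := by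
  rcases le_total 0 a with ha | ha
  · rw [abs_of_nonneg ha, ← Real.mul_rpow (by linarith) hy.le]
    gcongr
  · rw [abs_of_nonpos ha]
    have h3 : x ^ a ≤ (y / c) ^ a :=
      Real.rpow_le_rpow_of_nonpos (by positivity) (by
        rw [div_le_iff₀ (by linarith)]; linarith) ha
    refine h3.trans (le_of_eq ?_)
    rw [Real.div_rpow hy.le (by linarith), Real.rpow_neg (by linarith)]
    field_simp

/-- Weighted `ℓ^q` bound for convolution with a geometric tail. -/
lemma eLpNorm_tail_le {q : ℝ≥0∞} (α : ℝ) (hq : 1 ≤ q) :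
    ∃ C : ℝ≥0, ∀ b : ℕ → ℝ≥0∞,
      eLpNorm (fun n : ℕ => ENNReal.ofReal ((1 + n : ℝ) ^ α) *
        ∑' j : ℕ, if n < j then ENNReal.ofReal ((2 : ℝ) ^ (-((j : ℝ) - n) / 2)) * b j else 0)
          q Measure.count ≤
      C * eLpNorm (fun j : ℕ => ENNReal.ofReal ((1 + j : ℝ) ^ α) * b j) q Measure.count := by
  have hx : ∀ j : ℕ, (0 : ℝ) < 1 + j := fun j => by positivity
  set κ : ℕ → ℝ := fun i => (1 + i : ℝ) ^ |α| * (2 : ℝ) ^ (-(i : ℝ) / 2) with hκ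
  have hκ0 : ∀ i, 0 ≤ κ i := fun i => by positivity
  have hκs : Summable κ := summable_rpow_mul_two_rpow |α|
  set A : ℝ≥0 := (∑' i, κ i).toNNReal with hA
  have hAsum : ∑' i, ENNReal.ofReal (κ i) = A := (ENNReal.ofReal_tsum_of_nonneg hκ0 hκs).symm
  set K : ℕ → ℕ → ℝ≥0∞ := fun n j => if n < j then ENNReal.ofReal
    ((1 + n : ℝ) ^ α * (1 + j : ℝ) ^ (-α) * (2 : ℝ) ^ (-((j : ℝ) - n) / 2)) else 0 with hK
  have hKκ : ∀ n j, K n j ≤ if n < j then ENNReal.ofReal (κ (j - n)) else 0 := by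
    intro n j
    simp only [hK, hκ]
    split_ifs with h
    · refine ENNReal.ofReal_le_ofReal ?_
      have hc : ((j - n : ℕ) : ℝ) = j - n := by push_cast [h.le]; ring
      have hnj : (n : ℝ) ≤ j := by exact_mod_cast h.le
      have hn0 : (0 : ℝ) ≤ n := by positivity
      rw [hc]
      gcongr
      have := rpow_le_rpow_abs_mul (c := 1 + ((j : ℝ) - n)) α (hx n) (hx j) (by linarith)
        (by nlinarith) (by nlinarith)
      calc _ ≤ ((1 + ((j : ℝ) - n)) ^ |α| * (1 + j : ℝ) ^ α) * (1 + j : ℝ) ^ (-α) := by gcongr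
        _ = _ := by rw [mul_assoc, ← Real.rpow_add (hx j)]; simp
    · rfl
  have hrow : ∀ n, ∑' j, K n j ≤ A := fun n => by
    refine (ENNReal.tsum_le_tsum (hKκ n)).trans ?_
    rw [← hAsum]
    exact tsum_ite_comp_le_of_injOn (fun j => n < j) (fun j => j - n)
      (fun i => ENNReal.ofReal (κ i)) fun i hi j hj h => by
        simp only [mem_ofPred_eq] at hi hj h
        omega
  have hcol : ∀ j, ∑' n, K n j ≤ A := fun j => by
    refine (ENNReal.tsum_le_tsum (fun n => hKκ n j)).trans ?_
    rw [← hAsum]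
    exact tsum_ite_comp_le_of_injOn (fun n => n < j) (fun n => j - n)
      (fun i => ENNReal.ofReal (κ i)) fun i hi i' hi' h => by
        simp only [mem_ofPred_eq] at hi hi' h
        omega
  have hmain : ∃ C : ℝ≥0, ∀ x : ℕ → ℝ≥0∞, eLpNorm (fun n => ∑' j, K n j * x j) q
      Measure.count ≤ C * eLpNorm x q Measure.count := by
    rcases eq_or_ne q ∞ with rfl | hqt
    · exact ⟨A, fun x => eLpNorm_top_schur K hrow x⟩
    · exact eLpNorm_schur hq hqt K (fun _ => 1) (by simp) (by simp)
        (by simpa using hrow) (by simpa using hcol)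
  obtain ⟨C, hC⟩ := hmain
  refine ⟨C, fun b => ?_⟩
  refine le_trans (le_of_eq ?_) (hC _)
  congr 1
  funext n
  rw [← ENNReal.tsum_mul_left]
  refine tsum_congr fun j => ?_
  simp only [hK]
  split_ifs with h
  · rw [← mul_assoc, ← mul_assoc, ← ENNReal.ofReal_mul (by positivity),
      ← ENNReal.ofReal_mul (by positivity)]
    congr 2
    have := Real.rpow_add (hx j) (-α) α
    rw [neg_add_cancel, Real.rpow_zero] at this
    calc _ = (1 + n : ℝ) ^ α * 2 ^ (-((j : ℝ) - n) / 2) *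
        ((1 + j : ℝ) ^ (-α) * (1 + j : ℝ) ^ α) := by rw [← this, mul_one]
      _ = _ := by ring
  · simp


/-! ### Dyadic discretisation -/

lemma log_dyadic_bounds {k m : ℕ} (h1 : 2 ^ m ≤ k) (h2 : k < 2 ^ (m + 1)) :
    1 + Real.log k ≤ 2 * (1 + m) ∧ (1 + m : ℝ) ≤ 2 * (1 + Real.log k) := by
  have hk : (0 : ℝ) < k := by
    have : 0 < 2 ^ m := by positivity
    exact_mod_cast this.trans_le h1
  have h3 : m * Real.log 2 ≤ Real.log k := by
    rw [← Real.log_pow]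
    exact Real.log_le_log (by positivity) (by exact_mod_cast h1)
  have h4 : Real.log k ≤ (m + 1) * Real.log 2 := by
    have : Real.log k ≤ Real.log ((2 : ℝ) ^ (m + 1)) :=
      Real.log_le_log hk (by exact_mod_cast h2.le)
    rw [Real.log_pow] at this
    exact_mod_cast this
  have h5 := Real.log_two_gt_d9
  have h6 := Real.log_two_lt_d9
  have hm : (0 : ℝ) ≤ m := by positivity
  constructor <;> nlinarith

lemma eLpNorm_dyadic_le {q : ℝ≥0∞} (hq : q ≠ 0) (β : ℝ) {S : ℕ → ℝ≥0∞} (hS : Monotone S) :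
    eLpNorm (fun k : ℕ => ENNReal.ofReal ((k : ℝ) ^ (-q⁻¹.toReal) * (1 + Real.log k) ^ β) * S k)
      q (Measure.count.restrict (Ici 1)) ≤
    ((2 : ℝ≥0) ^ |β| : ℝ≥0) *
      eLpNorm (fun m : ℕ => ENNReal.ofReal ((1 + m : ℝ) ^ β) * S (2 ^ (m + 1))) q
        Measure.count := by
  set G : ℕ → ℝ≥0∞ := fun m => ENNReal.ofReal ((1 + m : ℝ) ^ β) * S (2 ^ (m + 1)) with hG
  set c : ℝ≥0 := (2 : ℝ≥0) ^ |β| with hc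
  have hcr : ENNReal.ofReal ((2 : ℝ) ^ |β|) = c := by
    rw [ENNReal.ofReal, Real.toNNReal_rpow_of_nonneg (by norm_num)]
    simp [hc]
  have key : ∀ k m : ℕ, 2 ^ m ≤ k → k < 2 ^ (m + 1) →
      ENNReal.ofReal ((k : ℝ) ^ (-q⁻¹.toReal) * (1 + Real.log k) ^ β) * S k ≤
      ENNReal.ofReal (((2 : ℝ) ^ m) ^ (-q⁻¹.toReal)) * (c * G m) := by
    intro k m h1 h2
    obtain ⟨h3, h4⟩ := log_dyadic_bounds h1 h2
    have hm : (0 : ℝ) < 1 + m := by positivity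
    have hl : 0 < 1 + Real.log k := by linarith
    rw [ENNReal.ofReal_mul (by positivity), mul_assoc, hG, ← hcr]
    gcongr ENNReal.ofReal ?_ * ?_
    · exact Real.rpow_le_rpow_of_nonpos (by positivity) (by exact_mod_cast h1)
        (neg_nonpos.2 ENNReal.toReal_nonneg)
    · rw [← mul_assoc, ← ENNReal.ofReal_mul (by positivity)]
      gcongr
      · exact rpow_le_rpow_abs_mul β hl hm (by norm_num) h3 h4
      · exact hS h2.le
  have hex : ∀ k : ℕ, 1 ≤ k → ∃ m, 2 ^ m ≤ k ∧ k < 2 ^ (m + 1) := fun k hk =>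
    ⟨Nat.log 2 k, Nat.pow_log_le_self 2 (by omega), Nat.lt_pow_succ_log_self (by norm_num) k⟩
  rcases eq_or_ne q ∞ with rfl | hqt
  · rw [eLpNorm_count_top, eLpNorm_exponent_top]
    refine essSup_le_of_ae_le _ ?_
    refine (ae_restrict_iff' measurableSet_Ici).2 (Filter.Eventually.of_forall fun k hk => ?_)
    obtain ⟨m, h1, h2⟩ := hex k hk
    refine (key k m h1 h2).trans ?_
    simp only [ENNReal.inv_top, ENNReal.toReal_zero, neg_zero, Real.rpow_zero,
      ENNReal.ofReal_one, one_mul]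
    gcongr
    exact le_iSup G m
  · have hq0 : 0 < q.toReal := ENNReal.toReal_pos hq hqt
    rw [eLpNorm_count_of_ne_top hq hqt, eLpNorm_eq_lintegral_rpow_enorm_toReal hq hqt,
      ← lintegral_indicator measurableSet_Ici, lintegral_count]
    have hle : ∀ k : ℕ, (Ici 1).indicator (fun k : ℕ => ‖ENNReal.ofReal ((k : ℝ) ^ (-q⁻¹.toReal)
        * (1 + Real.log k) ^ β) * S k‖ₑ ^ q.toReal) k ≤
        ∑' m : ℕ, if 2 ^ m ≤ k ∧ k < 2 ^ (m + 1) then ((2 : ℝ≥0∞) ^ m)⁻¹ *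
          (c * G m) ^ q.toReal else 0 := by
      intro k
      by_cases hk : 1 ≤ k
      · obtain ⟨m, h1, h2⟩ := hex k hk
        refine le_trans ?_ (ENNReal.le_tsum m)
        rw [if_pos ⟨h1, h2⟩, indicator_of_mem (by exact hk), enorm_eq_self]
        calc _ ≤ (ENNReal.ofReal (((2 : ℝ) ^ m) ^ (-q⁻¹.toReal)) * (c * G m)) ^ q.toReal :=
              ENNReal.rpow_le_rpow (key k m h1 h2) hq0.le
          _ = _ := by
              rw [ENNReal.mul_rpow_of_nonneg _ _ hq0.le,
                ENNReal.ofReal_rpow_of_nonneg (by positivity) hq0.le,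
                ← Real.rpow_mul (by positivity), ENNReal.toReal_inv, neg_mul,
                inv_mul_cancel₀ hq0.ne', Real.rpow_neg_one,
                ENNReal.ofReal_inv_of_pos (by positivity), ENNReal.ofReal_pow (by norm_num)]
              simp
      · rw [indicator_of_notMem (by exact hk)]
        exact zero_le
    have hsum : ∀ m : ℕ, ∑' k : ℕ, (if 2 ^ m ≤ k ∧ k < 2 ^ (m + 1) then ((2 : ℝ≥0∞) ^ m)⁻¹ *
          (c * G m) ^ q.toReal else 0) = (c * G m) ^ q.toReal := by
      intro m
      rw [tsum_eq_sum (s := Finset.Ico (2 ^ m) (2 ^ (m + 1))) (fun k hk => by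
        rw [if_neg]; simpa using hk)]
      rw [Finset.sum_congr rfl (g := fun _ => ((2 : ℝ≥0∞) ^ m)⁻¹ * (c * G m) ^ q.toReal)
        (fun k hk => by rw [if_pos]; simpa using hk)]
      rw [Finset.sum_const, Nat.card_Ico, pow_succ, mul_two, Nat.add_sub_cancel, nsmul_eq_mul,
        ← mul_assoc]
      push_cast
      rw [ENNReal.mul_inv_cancel (by simp) (by finiteness), one_mul]
    calc _ ≤ (∑' m, (c * G m) ^ q.toReal) ^ (1 / q.toReal) := by
          gcongr ?_ ^ _
          refine (ENNReal.tsum_le_tsum hle).trans ?_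
          rw [ENNReal.tsum_comm]
          exact (tsum_congr hsum).le
      _ = _ := by
          simp_rw [ENNReal.mul_rpow_of_nonneg _ _ hq0.le]
          rw [ENNReal.tsum_mul_left, ENNReal.mul_rpow_of_nonneg _ _ (by positivity),
            ← ENNReal.rpow_mul, mul_one_div_cancel hq0.ne', ENNReal.rpow_one]

lemma dyadic_weight_le {q : ℝ≥0∞} (hq : 2 ≤ q) (α : ℝ) (j : ℕ) {t : ℝ}
    (ht : t ∈ Ioo ((2 : ℝ) ^ (-((j : ℝ) + 1))) ((2 : ℝ) ^ (-(j : ℝ)))) :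
    (1 + j : ℝ) ^ α * (2 : ℝ) ^ (-(j : ℝ) / 2) ≤
      (2 : ℝ) ^ (1 + |α|) * (2 : ℝ) ^ (-(j : ℝ) * q⁻¹.toReal) *
        (t ^ ((2 : ℝ≥0∞)⁻¹.toReal - q⁻¹.toReal) * (1 + |Real.log t|) ^ α) := by
  have ht0 : 0 < t := lt_trans (by positivity) ht.1
  have hj : (0 : ℝ) ≤ j := by positivity
  have hlog1 : -((j : ℝ) + 1) * Real.log 2 ≤ Real.log t := by
    rw [← Real.log_rpow (by norm_num)]
    exact Real.log_le_log (by positivity) ht.1.le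
  have hlog2 : Real.log t ≤ -(j : ℝ) * Real.log 2 := by
    rw [← Real.log_rpow (by norm_num)]
    exact Real.log_le_log ht0 ht.2.le
  have h5 := Real.log_two_gt_d9
  have h6 := Real.log_two_lt_d9
  have habs : |Real.log t| = -Real.log t := abs_of_nonpos (by nlinarith)
  have hw : (1 + j : ℝ) ^ α ≤ 2 ^ |α| * (1 + |Real.log t|) ^ α :=
    rpow_le_rpow_abs_mul α (by positivity) (by positivity) (by norm_num)
      (by rw [habs]; nlinarith) (by rw [habs]; nlinarith)
  set e : ℝ := (2 : ℝ≥0∞)⁻¹.toReal - q⁻¹.toReal with he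
  have h2 : (2 : ℝ≥0∞)⁻¹.toReal = 1 / 2 := by simp
  have he0 : 0 ≤ e := by
    have : q⁻¹.toReal ≤ (2 : ℝ≥0∞)⁻¹.toReal :=
      ENNReal.toReal_mono (by simp) (ENNReal.inv_le_inv.2 hq)
    linarith
  have he1 : e ≤ 1 := by
    have : 0 ≤ q⁻¹.toReal := ENNReal.toReal_nonneg
    linarith
  have ht1 : (2 : ℝ) ^ (-((j : ℝ) + 1) * e) ≤ t ^ e := by
    rw [Real.rpow_mul (by norm_num)]
    exact Real.rpow_le_rpow (by positivity) ht.1.le he0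
  have ht2 : (2 : ℝ) ^ (-(j : ℝ) / 2) ≤ 2 * (2 : ℝ) ^ (-(j : ℝ) * q⁻¹.toReal) * t ^ e := by
    calc (2 : ℝ) ^ (-(j : ℝ) / 2) ≤
        (2 : ℝ) ^ (1 + -(j : ℝ) * q⁻¹.toReal + -((j : ℝ) + 1) * e) := by
          refine Real.rpow_le_rpow_of_exponent_le (by norm_num) ?_
          rw [h2] at he
          have : q⁻¹.toReal = 1 / 2 - e := by linarith
          rw [this]
          linarith
      _ = 2 * (2 : ℝ) ^ (-(j : ℝ) * q⁻¹.toReal) * (2 : ℝ) ^ (-((j : ℝ) + 1) * e) := by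
          rw [Real.rpow_add (by norm_num), Real.rpow_add (by norm_num), Real.rpow_one]
      _ ≤ _ := by gcongr
  calc _ ≤ (2 ^ |α| * (1 + |Real.log t|) ^ α) *
        (2 * (2 : ℝ) ^ (-(j : ℝ) * q⁻¹.toReal) * t ^ e) := by gcongr
    _ = _ := by
      rw [Real.rpow_add (by norm_num), Real.rpow_one]
      ring

lemma eLpNorm_dyadic_samples_le {q : ℝ≥0∞} (hq : 2 ≤ q) (α : ℝ) :
    ∃ C : ℝ≥0, ∀ R : ℝ → ℝ≥0∞, Antitone R →
    eLpNorm (fun j : ℕ => ENNReal.ofReal ((1 + j : ℝ) ^ α) *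
      (ENNReal.ofReal ((2 : ℝ) ^ (-(j : ℝ) / 2)) * R ((2 : ℝ) ^ (-(j : ℝ))))) q Measure.count ≤
    C * eLpNorm (fun t : ℝ => ENNReal.ofReal
      (t ^ ((2 : ℝ≥0∞)⁻¹.toReal - q⁻¹.toReal) * (1 + |Real.log t|) ^ α) * R t) q
        (volume.restrict (Ioo (0 : ℝ) 1)) := by
  set c : ℝ≥0 := ((2 : ℝ) ^ (1 + |α|)).toNNReal with hc
  set I : ℕ → Set ℝ := fun j => Ioo ((2 : ℝ) ^ (-((j : ℝ) + 1))) ((2 : ℝ) ^ (-(j : ℝ))) with hI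
  have hIm : ∀ j, MeasurableSet (I j) := fun j => measurableSet_Ioo
  have hI01 : ∀ j, I j ⊆ Ioo 0 1 := fun j t ht =>
    ⟨lt_trans (by positivity) ht.1, ht.2.trans_le
      (Real.rpow_le_one_of_one_le_of_nonpos (by norm_num) (by simp))⟩
  have hIvol : ∀ j, volume (I j) = 2⁻¹ * ENNReal.ofReal ((2 : ℝ) ^ (-(j : ℝ))) := by
    intro j
    have : (2 : ℝ≥0∞)⁻¹ = ENNReal.ofReal (1 / 2) := by
      rw [one_div, ENNReal.ofReal_inv_of_pos (by norm_num)]; simp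
    rw [hI, Real.volume_Ioo, this, ← ENNReal.ofReal_mul (by norm_num)]
    congr 1
    rw [neg_add, Real.rpow_add (by norm_num), Real.rpow_neg_one]
    ring
  have hdisj : Pairwise (Function.onFun Disjoint I) := by
    have aux : ∀ i j : ℕ, i < j → Disjoint (I i) (I j) := by
      intro i j hij
      rw [Set.disjoint_left]
      intro t hti htj
      have h1 : (2 : ℝ) ^ (-(j : ℝ)) ≤ (2 : ℝ) ^ (-((i : ℝ) + 1)) := by
        refine Real.rpow_le_rpow_of_exponent_le (by norm_num) ?_
        have : ((i + 1 : ℕ) : ℝ) ≤ j := by exact_mod_cast hij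
        push_cast at this
        linarith
      have := htj.2
      have := hti.1
      linarith
    intro i j hij
    rcases lt_or_gt_of_ne hij with h | h
    · exact aux i j h
    · exact (aux j i h).symm
  refine ⟨2 * c, fun R hR => ?_⟩
  set F : ℝ → ℝ≥0∞ := fun t => ENNReal.ofReal
      (t ^ ((2 : ℝ≥0∞)⁻¹.toReal - q⁻¹.toReal) * (1 + |Real.log t|) ^ α) * R t with hF
  set G : ℕ → ℝ≥0∞ := fun j => ENNReal.ofReal ((1 + j : ℝ) ^ α) *
      (ENNReal.ofReal ((2 : ℝ) ^ (-(j : ℝ) / 2)) * R ((2 : ℝ) ^ (-(j : ℝ)))) with hG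
  have key : ∀ j, ∀ t ∈ I j, G j ≤
      ENNReal.ofReal ((2 : ℝ) ^ (-(j : ℝ) * q⁻¹.toReal)) * (c * F t) := by
    intro j t ht
    have h := ENNReal.ofReal_le_ofReal (dyadic_weight_le hq α j ht)
    have ht0 : 0 < t := (hI01 j ht).1
    rw [ENNReal.ofReal_mul (by positivity), ENNReal.ofReal_mul (by positivity),
      ENNReal.ofReal_mul (by positivity)] at h
    simp only [hG, hF]
    rw [← mul_assoc]
    calc _ ≤ _ := mul_le_mul' h (hR ht.2.le)
      _ = _ := by
        rw [hc, ← ENNReal.ofReal]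
        ring
  rcases eq_or_ne q ∞ with rfl | hqt
  · rw [eLpNorm_count_top]
    refine iSup_le fun j => ?_
    have hae : ∀ᵐ t ∂(volume.restrict (I j)), F t ≤
        eLpNorm F ∞ (volume.restrict (Ioo (0 : ℝ) 1)) := by
      refine ae_restrict_of_ae_restrict_of_subset (hI01 j) ?_
      have := enorm_ae_le_eLpNormEssSup F (volume.restrict (Ioo (0 : ℝ) 1))
      simpa only [enorm_eq_self, eLpNorm_exponent_top] using this
    have hne : (volume.restrict (I j)) ≠ 0 := by
      rw [Ne, Measure.restrict_eq_zero, hIvol]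
      have : (0 : ℝ) < 2 ^ (-(j : ℝ)) := by positivity
      simp
    have : (ae (volume.restrict (I j))).NeBot := ae_neBot.2 hne
    obtain ⟨t, ht, htI⟩ := (hae.and (ae_restrict_mem (hIm j))).exists
    refine (key j t htI).trans ?_
    simp only [ENNReal.inv_top, ENNReal.toReal_zero, mul_zero, Real.rpow_zero,
      ENNReal.ofReal_one, one_mul]
    calc (c : ℝ≥0∞) * F t ≤ c * eLpNorm F ∞ (volume.restrict (Ioo (0 : ℝ) 1)) := by gcongr
      _ ≤ _ := by
        gcongr
        exact le_mul_of_one_le_left zero_le (by norm_num)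
  · have hq0' : q ≠ 0 := (lt_of_lt_of_le (by simp) hq).ne'
    have hq0 : 0 < q.toReal := ENNReal.toReal_pos hq0' hqt
    have hq1 : 1 ≤ q.toReal := by
      have := (ENNReal.toReal_le_toReal (by simp) hqt).2 hq
      simp only [ENNReal.toReal_ofNat] at this
      linarith
    rw [eLpNorm_count_of_ne_top hq0' hqt, eLpNorm_eq_lintegral_rpow_enorm_toReal hq0' hqt]
    simp only [enorm_eq_self]
    have hblock : ∀ j, G j ^ q.toReal ≤ 2 * (c : ℝ≥0∞) ^ q.toReal *
        ∫⁻ t in I j, F t ^ q.toReal := by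
      intro j
      set d : ℝ≥0∞ := ENNReal.ofReal ((2 : ℝ) ^ (-(j : ℝ))) with hd
      have hd0 : d ≠ 0 := by
        have : (0 : ℝ) < 2 ^ (-(j : ℝ)) := by positivity
        simp [hd]
      have hdt : d ≠ ∞ := ENNReal.ofReal_ne_top
      have h1 : ∀ t ∈ I j, G j ^ q.toReal ≤ d * (c : ℝ≥0∞) ^ q.toReal * F t ^ q.toReal := by
        intro t ht
        calc G j ^ q.toReal ≤ _ := ENNReal.rpow_le_rpow (key j t ht) hq0.le
          _ = _ := by
            rw [ENNReal.mul_rpow_of_nonneg _ _ hq0.le, ENNReal.mul_rpow_of_nonneg _ _ hq0.le,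
              ENNReal.ofReal_rpow_of_nonneg (by positivity) hq0.le,
              ← Real.rpow_mul (by positivity), ENNReal.toReal_inv, mul_assoc (-(j : ℝ)),
              inv_mul_cancel₀ hq0.ne', mul_one, mul_assoc]
      have h2 : G j ^ q.toReal * (2⁻¹ * d) ≤
          d * (c : ℝ≥0∞) ^ q.toReal * ∫⁻ t in I j, F t ^ q.toReal := by
        rw [← hIvol j, ← setLIntegral_const, ← lintegral_const_mul' _ _ (by finiteness)]
        exact setLIntegral_mono' (hIm j) h1
      have h3 : G j ^ q.toReal = 2 * d⁻¹ * (G j ^ q.toReal * (2⁻¹ * d)) := by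
        calc _ = G j ^ q.toReal * (2 * 2⁻¹) * (d * d⁻¹) := by
              rw [ENNReal.mul_inv_cancel hd0 hdt, ENNReal.mul_inv_cancel (by simp) (by simp)]
              simp
          _ = _ := by ring
      rw [h3]
      calc _ ≤ 2 * d⁻¹ * (d * (c : ℝ≥0∞) ^ q.toReal * ∫⁻ t in I j, F t ^ q.toReal) := by gcongr
        _ = 2 * (d * d⁻¹) * (c : ℝ≥0∞) ^ q.toReal * ∫⁻ t in I j, F t ^ q.toReal := by ring
        _ = _ := by rw [ENNReal.mul_inv_cancel hd0 hdt, mul_one]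
    have hsum : ∑' j, G j ^ q.toReal ≤ 2 * (c : ℝ≥0∞) ^ q.toReal *
        ∫⁻ t in Ioo (0 : ℝ) 1, F t ^ q.toReal := by
      refine (ENNReal.tsum_le_tsum hblock).trans ?_
      rw [ENNReal.tsum_mul_left, ← lintegral_iUnion hIm hdisj]
      gcongr
      exact iUnion_subset hI01
    calc _ ≤ (2 * (c : ℝ≥0∞) ^ q.toReal *
        ∫⁻ t in Ioo (0 : ℝ) 1, F t ^ q.toReal) ^ (1 / q.toReal) := by gcongr
      _ = 2 ^ (1 / q.toReal) * c * (∫⁻ t in Ioo (0 : ℝ) 1, F t ^ q.toReal) ^ (1 / q.toReal) := by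
        rw [ENNReal.mul_rpow_of_nonneg _ _ (by positivity),
          ENNReal.mul_rpow_of_nonneg _ _ (by positivity), ← ENNReal.rpow_mul,
          mul_one_div_cancel hq0.ne', ENNReal.rpow_one]
      _ ≤ _ := by
        rw [ENNReal.coe_mul]
        gcongr
        calc (2 : ℝ≥0∞) ^ (1 / q.toReal) ≤ 2 ^ (1 : ℝ) :=
              ENNReal.rpow_le_rpow_of_exponent_le (by norm_num)
                (by rw [div_le_one hq0]; exact hq1)
          _ = _ := by simp


/-! ### Rearrangements of families -/

section Seq
variable {ι : Type*}

/-- `(∑_{i ≤ k} (c_i^*)²)^{1/2}`. -/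
noncomputable def partialNorm (c : ι → ℂ) (k : ℕ) : ℝ≥0∞ :=
  (∑ i ∈ Finset.Icc 1 k, seqRearrangement c i ^ (2 : ℝ)) ^ (1 / 2 : ℝ)

lemma partialNorm_mono (c : ι → ℂ) : Monotone (partialNorm c) := fun k l h => by
  unfold partialNorm
  gcongr

lemma seqLNorm_eq_partialNorm (q : ℝ≥0∞) (β : ℝ) (c : ι → ℂ) :
    seqLNorm 2 q β 2 c = eLpNorm (fun k : ℕ =>
      ENNReal.ofReal ((k : ℝ) ^ (-q⁻¹.toReal) * (1 + Real.log k) ^ β) * partialNorm c k) q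
        (Measure.count.restrict (Ici 1)) := by
  unfold seqLNorm
  congr 1
  funext k
  congr 1
  rw [eLpNorm_eq_lintegral_rpow_enorm_toReal (by simp) (by simp), partialNorm]
  have : (Icc 1 k : Set ℕ) = (Finset.Icc 1 k : Finset ℕ) := by simp
  rw [this, lintegral_finset]
  simp

lemma seqRearrangement_le_of_forall_le {d : ι → ℂ} {D : ℝ≥0∞} (h : ∀ n, ‖d n‖ₑ ≤ D) {i : ℕ}
    (hi : 1 ≤ i) : seqRearrangement d i ≤ D := by
  refine sInf_le ?_
  have : {n | D < ‖d n‖ₑ} = ∅ := by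
    ext n
    simpa using h n
  simp only [mem_ofPred_eq, this, encard_empty]
  exact_mod_cast hi

lemma seqRearrangement_le_add {c d e : ι → ℂ} {E : ℝ≥0∞} (hc : ∀ n, c n = d n + e n)
    (he : ∀ n, ‖e n‖ₑ ≤ E) (i : ℕ) :
    seqRearrangement c i ≤ seqRearrangement d i + E := by
  unfold seqRearrangement
  rw [ENNReal.sInf_add]
  refine le_iInf₂ fun s hs => sInf_le ?_
  refine lt_of_le_of_lt (encard_le_encard fun n hn => ?_) hs
  simp only [mem_ofPred_eq] at hn ⊢
  by_contra! hle
  refine absurd hn (not_lt.2 ?_)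
  rw [hc n]
  exact (enorm_add_le _ _).trans (add_le_add hle (he n))

lemma partialNorm_le_add {c d e : ι → ℂ} {E : ℝ≥0∞} (hc : ∀ n, c n = d n + e n)
    (he : ∀ n, ‖e n‖ₑ ≤ E) (k : ℕ) :
    partialNorm c k ≤ partialNorm d k + (k : ℝ≥0∞) ^ (1 / 2 : ℝ) * E := by
  unfold partialNorm
  calc _ ≤ (∑ i ∈ Finset.Icc 1 k, (seqRearrangement d i + E) ^ (2 : ℝ)) ^ (1 / 2 : ℝ) := by
        gcongr with i
        exact seqRearrangement_le_add hc he i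
    _ ≤ (∑ i ∈ Finset.Icc 1 k, seqRearrangement d i ^ (2 : ℝ)) ^ (1 / 2 : ℝ) +
        (∑ i ∈ Finset.Icc 1 k, E ^ (2 : ℝ)) ^ (1 / 2 : ℝ) :=
        ENNReal.Lp_add_le (Finset.Icc 1 k) (seqRearrangement d) (fun _ => E) (by norm_num)
    _ = _ := by
        rw [Finset.sum_const, Nat.card_Icc, nsmul_eq_mul, Nat.add_sub_cancel,
          ENNReal.mul_rpow_of_nonneg _ _ (by norm_num), ← ENNReal.rpow_mul]
        norm_num

/-- Distinct indices realising given lower bounds can be chosen greedily. -/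
lemma exists_finset_sum_sq_le (d : ι → ℂ) (l : ℕ → ℝ≥0∞) (k : ℕ)
    (h : ∀ i ∈ Finset.Icc 1 k, l i = 0 ∨ (i : ℕ∞) ≤ {n | l i < ‖d n‖ₑ}.encard) :
    ∃ F : Finset ι, F.card ≤ k ∧
      ∑ i ∈ Finset.Icc 1 k, l i ^ (2 : ℝ) ≤ ∑ n ∈ F, ‖d n‖ₑ ^ (2 : ℝ) := by
  classical
  induction k with
  | zero => exact ⟨∅, by simp⟩
  | succ k ih =>
    obtain ⟨F, hF, hsum⟩ := ih fun i hi => h i (by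
      rw [Finset.mem_Icc] at hi ⊢; omega)
    rw [Finset.sum_Icc_succ_top (by omega)]
    rcases h (k + 1) (by simp) with h0 | h1
    · exact ⟨F, by omega, by simpa [h0] using hsum⟩
    · obtain ⟨n, hn, hnF⟩ : ∃ n ∈ {n | l (k + 1) < ‖d n‖ₑ}, n ∉ (F : Set ι) := by
        by_contra! hcon
        have h2 : ((k + 1 : ℕ) : ℕ∞) ≤ F.card :=
          h1.trans ((encard_le_encard hcon).trans (encard_coe_eq_coe_finsetCard F).le)
        have : k + 1 ≤ F.card := by exact_mod_cast h2
        omega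
      have hnF' : n ∉ F := by simpa using hnF
      refine ⟨insert n F, by rw [Finset.card_insert_of_notMem hnF']; omega, ?_⟩
      rw [Finset.sum_insert hnF', add_comm]
      gcongr
      exact (show l (k + 1) < ‖d n‖ₑ from hn).le

lemma partialNorm_le_of_sum_le {d : ι → ℂ} {D : ℝ≥0∞}
    (h : ∀ F : Finset ι, ∑ n ∈ F, ‖d n‖ₑ ^ (2 : ℝ) ≤ D ^ (2 : ℝ)) (k : ℕ) :
    partialNorm d k ≤ D := by
  rcases eq_or_ne D ∞ with rfl | hD
  · exact le_top
  have hle : ∀ n, ‖d n‖ₑ ≤ D := fun n => by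
    have := h {n}
    rw [Finset.sum_singleton] at this
    exact (ENNReal.rpow_le_rpow_iff (by norm_num)).1 this
  have key : ∀ θ : ℝ≥0, θ < 1 → θ * partialNorm d k ≤ D := by
    intro θ hθ
    obtain ⟨F, -, hF⟩ := exists_finset_sum_sq_le d (fun i => θ * seqRearrangement d i) k
      (fun i hi => by
        rw [Finset.mem_Icc] at hi
        rcases eq_or_ne (seqRearrangement d i) 0 with h0 | h0
        · left; simp [h0]
        · right
          have hfin : seqRearrangement d i ≠ ∞ :=
            ne_top_of_le_ne_top hD (seqRearrangement_le_of_forall_le hle hi.1)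
          have hlt : θ * seqRearrangement d i < seqRearrangement d i := by
            conv_rhs => rw [← one_mul (seqRearrangement d i)]
            exact (ENNReal.mul_lt_mul_iff_left h0 hfin).2 (by exact_mod_cast hθ)
          by_contra! hcon
          exact absurd (show seqRearrangement d i ≤ _ from sInf_le hcon) (not_le.2 hlt))
    have h2 := hF.trans (h F)
    simp_rw [ENNReal.mul_rpow_of_nonneg _ _ (show (0 : ℝ) ≤ 2 by norm_num)] at h2
    rw [← Finset.mul_sum] at h2
    have h3 := ENNReal.rpow_le_rpow h2 (show (0 : ℝ) ≤ 1 / 2 by norm_num)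
    rw [ENNReal.mul_rpow_of_nonneg _ _ (by norm_num), ← ENNReal.rpow_mul, ← ENNReal.rpow_mul]
      at h3
    simpa [partialNorm] using h3
  have hone : (1 : ℝ≥0∞) * partialNorm d k ≤ D := by
    refine ENNReal.mul_le_of_forall_lt fun a ha b hb => ?_
    have hat : a ≠ ∞ := (ha.trans ENNReal.one_lt_top).ne
    lift a to ℝ≥0 using hat
    exact (mul_le_mul_right hb.le _).trans (key a (by exact_mod_cast ha))
  simpa using hone

end Seq


/-! ### Rearrangements of functions -/

instance : IsProbabilityMeasure μI := ⟨by simp⟩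

lemma rearrangement_antitone (f : ℝ → ℂ) : Antitone (rearrangement f) := fun _ _ h =>
  sInf_le_sInf fun _ hs => le_trans hs (ENNReal.ofReal_le_ofReal h)

lemma lt_rearrangement_iff (f : ℝ → ℂ) (s : ℝ≥0∞) (t : ℝ) :
    s < rearrangement f t ↔ ENNReal.ofReal t < μI {x | s < ‖f x‖ₑ} := by
  rw [← not_le, ← not_le, not_iff_not]
  refine ⟨fun h => ?_, fun h => sInf_le h⟩
  rcases eq_or_ne s ∞ with rfl | hs
  · simp
  obtain ⟨u, hanti, hu, hlim⟩ := exists_seq_strictAnti_tendsto' (lt_top_iff_ne_top.2 hs)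
  have hun : {x | s < ‖f x‖ₑ} = ⋃ n, {x | u n < ‖f x‖ₑ} := by
    ext x
    simp only [mem_ofPred_eq, mem_iUnion]
    exact ⟨fun hx => (hlim.eventually_lt_const hx).exists,
      fun ⟨n, hn⟩ => (hu n).1.trans hn⟩
  have hmono : Monotone fun n => {x | u n < ‖f x‖ₑ} :=
    fun i j hij x (hx : u i < _) => (hanti.antitone hij).trans_lt hx
  rw [hun, hmono.measure_iUnion]
  refine iSup_le fun n => ?_
  obtain ⟨s', hs', hlt⟩ := sInf_lt_iff.1 (lt_of_le_of_lt h (hu n).1)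
  exact (measure_mono fun x (hx : u n < _) => hlt.trans hx).trans hs'

lemma map_enorm_eq_map_rearrangement {f : ℝ → ℂ} (hf : AEStronglyMeasurable f μI) :
    Measure.map (fun x => ‖f x‖ₑ) μI =
      Measure.map (rearrangement f) (volume.restrict (Ioo (0 : ℝ) 1)) := by
  have hR : Measurable (rearrangement f) := (rearrangement_antitone f).measurable
  have hfe : AEMeasurable (fun x => ‖f x‖ₑ) μI := hf.enorm
  refine ext_of_generate_finite (range Ioi)
    (by rw [← borel_eq_generateFrom_Ioi]; exact BorelSpace.measurable_eq) isPiSystem_Ioi ?_ ?_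
  · rintro _ ⟨s, rfl⟩
    rw [Measure.map_apply_of_aemeasurable hfe measurableSet_Ioi,
      Measure.map_apply hR measurableSet_Ioi,
      Measure.restrict_apply (hR measurableSet_Ioi)]
    set d := μI {x | s < ‖f x‖ₑ} with hd
    have hd1 : d ≤ 1 := prob_le_one
    have hdt : d ≠ ∞ := ne_top_of_le_ne_top ENNReal.one_ne_top hd1
    have : rearrangement f ⁻¹' Ioi s ∩ Ioo 0 1 = Ioo 0 d.toReal := by
      ext t
      simp only [mem_inter_iff, mem_preimage, mem_Ioi, lt_rearrangement_iff, mem_Ioo]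
      have hd2 : d.toReal ≤ 1 := by
        simpa using (ENNReal.toReal_le_toReal hdt ENNReal.one_ne_top).2 hd1
      rw [← hd]
      constructor
      · rintro ⟨h1, h2, h3⟩
        exact ⟨h2, (ENNReal.ofReal_lt_iff_lt_toReal h2.le hdt).1 h1⟩
      · rintro ⟨h1, h2⟩
        exact ⟨(ENNReal.ofReal_lt_iff_lt_toReal h1.le hdt).2 h2, h1, h2.trans_le hd2⟩
    rw [this, Real.volume_Ioo, sub_zero, ENNReal.ofReal_toReal hdt]
    rfl
  · rw [Measure.map_apply_of_aemeasurable hfe MeasurableSet.univ,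
      Measure.map_apply hR MeasurableSet.univ]
    simp

lemma lintegral_comp_enorm_eq {f : ℝ → ℂ} (hf : AEStronglyMeasurable f μI) {h : ℝ≥0∞ → ℝ≥0∞}
    (hh : Measurable h) :
    ∫⁻ x, h ‖f x‖ₑ ∂μI = ∫⁻ t in Ioo (0 : ℝ) 1, h (rearrangement f t) := by
  have hR : Measurable (rearrangement f) := (rearrangement_antitone f).measurable
  rw [← lintegral_map' hh.aemeasurable hf.enorm, map_enorm_eq_map_rearrangement hf,
    lintegral_map hh hR]

lemma volume_Ioc_dyadic (j : ℕ) :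
    volume (Ioc ((2 : ℝ) ^ (-((j + 1 : ℕ) : ℝ))) ((2 : ℝ) ^ (-(j : ℝ)))) =
      ENNReal.ofReal ((2 : ℝ) ^ (-((j + 1 : ℕ) : ℝ))) := by
  rw [Real.volume_Ioc]
  congr 1
  push_cast
  rw [neg_add, Real.rpow_add (by norm_num), Real.rpow_neg_one]
  ring

lemma exists_mem_Ioc_dyadic {t : ℝ} (ht : t ∈ Ioo (0 : ℝ) 1) :
    ∃ j : ℕ, t ∈ Ioc ((2 : ℝ) ^ (-((j + 1 : ℕ) : ℝ))) ((2 : ℝ) ^ (-(j : ℝ))) := by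
  obtain ⟨n, hn1, hn2⟩ := exists_nat_pow_near_of_lt_one ht.1 ht.2.le
    (show (0 : ℝ) < 1 / 2 by norm_num) (by norm_num)
  have e : ∀ m : ℕ, (2 : ℝ) ^ (-(m : ℝ)) = (1 / 2) ^ m := fun m => by
    rw [Real.rpow_neg (by norm_num), Real.rpow_natCast, one_div, inv_pow]
  exact ⟨n, by rw [e]; exact hn1, by rw [e]; exact hn2⟩

lemma dyadic_antitone {i j : ℕ} (h : i ≤ j) : (2 : ℝ) ^ (-(j : ℝ)) ≤ (2 : ℝ) ^ (-(i : ℝ)) :=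
  Real.rpow_le_rpow_of_exponent_le (by norm_num) (neg_le_neg (by exact_mod_cast h))

lemma lintegral_above_le (f : ℝ → ℂ) (n : ℕ) :
    ∫⁻ t in Ioo (0 : ℝ) 1, (Ioi (rearrangement f ((2 : ℝ) ^ (-(n : ℝ))))).indicator id
        (rearrangement f t) ≤
      ∑' j : ℕ, if n < j then ENNReal.ofReal ((2 : ℝ) ^ (-(j : ℝ))) *
        rearrangement f ((2 : ℝ) ^ (-(j : ℝ))) else 0 := by
  set R := rearrangement f with hRdef
  have hR : Antitone R := rearrangement_antitone f
  set g : ℕ → ℝ≥0∞ := fun j => if n < j then ENNReal.ofReal ((2 : ℝ) ^ (-(j : ℝ))) *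
        R ((2 : ℝ) ^ (-(j : ℝ))) else 0 with hg
  have hblock : ∀ j : ℕ, ∫⁻ t in Ioc ((2 : ℝ) ^ (-((j + 1 : ℕ) : ℝ))) ((2 : ℝ) ^ (-(j : ℝ))),
      (Ioi (R ((2 : ℝ) ^ (-(n : ℝ))))).indicator id (R t) ≤ g (j + 1) := by
    intro j
    have hpt : ∀ t ∈ Ioc ((2 : ℝ) ^ (-((j + 1 : ℕ) : ℝ))) ((2 : ℝ) ^ (-(j : ℝ))),
        (Ioi (R ((2 : ℝ) ^ (-(n : ℝ))))).indicator id (R t) ≤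
          if n < j + 1 then R ((2 : ℝ) ^ (-((j + 1 : ℕ) : ℝ))) else 0 := by
      intro t ht
      split_ifs with h
      · exact (indicator_le_self' (fun _ _ => zero_le) _).trans (hR ht.1.le)
      · rw [indicator_of_notMem]
        rw [mem_Ioi, not_lt]
        exact hR ((dyadic_antitone (by omega)).trans ht.1.le)
    refine (setLIntegral_mono' measurableSet_Ioc hpt).trans ?_
    rw [setLIntegral_const, volume_Ioc_dyadic]
    simp only [hg]
    split_ifs
    · rw [mul_comm]
    · simp
  calc _ ≤ ∫⁻ t in ⋃ j : ℕ, Ioc ((2 : ℝ) ^ (-((j + 1 : ℕ) : ℝ))) ((2 : ℝ) ^ (-(j : ℝ))),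
        (Ioi (R ((2 : ℝ) ^ (-(n : ℝ))))).indicator id (R t) :=
        lintegral_mono_set fun t ht => mem_iUnion.2 (exists_mem_Ioc_dyadic ht)
    _ ≤ ∑' j, g (j + 1) :=
        (lintegral_iUnion_le _ _).trans (ENNReal.tsum_le_tsum hblock)
    _ ≤ _ := ENNReal.tsum_comp_le_tsum_of_injective (add_left_injective 1) g

lemma lintegral_below_le (f : ℝ → ℂ) (n : ℕ) :
    ∫⁻ t in Ioo (0 : ℝ) 1, (Iic (rearrangement f ((2 : ℝ) ^ (-(n : ℝ))))).indicator
        (fun x => x ^ (2 : ℝ)) (rearrangement f t) ≤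
      2 * ∑ j ∈ Finset.range (n + 1), ENNReal.ofReal ((2 : ℝ) ^ (-(j : ℝ))) *
        rearrangement f ((2 : ℝ) ^ (-(j : ℝ))) ^ (2 : ℝ) := by
  set R := rearrangement f with hRdef
  have hR : Antitone R := rearrangement_antitone f
  set g : ℕ → ℝ≥0∞ := fun j => ENNReal.ofReal ((2 : ℝ) ^ (-(j : ℝ))) *
        R ((2 : ℝ) ^ (-(j : ℝ))) ^ (2 : ℝ) with hg
  have h1 : ∀ n : ℕ, ∫⁻ t in Ioc ((2 : ℝ) ^ (-(n : ℝ))) 1, R t ^ (2 : ℝ) ≤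
      ∑ j ∈ Finset.range n, g (j + 1) := by
    intro n
    induction n with
    | zero => simp
    | succ n ih =>
      have hsub : Ioc ((2 : ℝ) ^ (-((n + 1 : ℕ) : ℝ))) 1 ⊆ Ioc ((2 : ℝ) ^ (-(n : ℝ))) 1 ∪
          Ioc ((2 : ℝ) ^ (-((n + 1 : ℕ) : ℝ))) ((2 : ℝ) ^ (-(n : ℝ))) := by
        intro t ht
        rcases le_or_gt t ((2 : ℝ) ^ (-(n : ℝ))) with h | h
        · exact Or.inr ⟨ht.1, h⟩
        · exact Or.inl ⟨h, ht.2⟩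
      rw [Finset.sum_range_succ]
      refine (lintegral_mono_set hsub).trans ((lintegral_union_le _ _ _).trans
        (add_le_add ih ?_))
      calc _ ≤ ∫⁻ t in Ioc ((2 : ℝ) ^ (-((n + 1 : ℕ) : ℝ))) ((2 : ℝ) ^ (-(n : ℝ))),
            R ((2 : ℝ) ^ (-((n + 1 : ℕ) : ℝ))) ^ (2 : ℝ) :=
            setLIntegral_mono' measurableSet_Ioc fun t ht =>
              ENNReal.rpow_le_rpow (hR ht.1.le) (by norm_num)
        _ = g (n + 1) := by rw [setLIntegral_const, volume_Ioc_dyadic, hg, mul_comm]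
  have h2 : ∫⁻ t in Ioc 0 ((2 : ℝ) ^ (-(n : ℝ))), (Iic (R ((2 : ℝ) ^ (-(n : ℝ))))).indicator
        (fun x => x ^ (2 : ℝ)) (R t) ≤ g n := by
    calc _ ≤ ∫⁻ t in Ioc 0 ((2 : ℝ) ^ (-(n : ℝ))), R ((2 : ℝ) ^ (-(n : ℝ))) ^ (2 : ℝ) := by
          refine lintegral_mono fun t => ?_
          by_cases h : R t ∈ Iic (R ((2 : ℝ) ^ (-(n : ℝ))))
          · simp only [indicator_of_mem h]
            exact ENNReal.rpow_le_rpow h (by norm_num)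
          · simp only [indicator_of_notMem h]
            exact zero_le
      _ = _ := by rw [setLIntegral_const, Real.volume_Ioc, sub_zero, hg, mul_comm]
  have hsub : Ioo (0 : ℝ) 1 ⊆ Ioc ((2 : ℝ) ^ (-(n : ℝ))) 1 ∪ Ioc 0 ((2 : ℝ) ^ (-(n : ℝ))) := by
    intro t ht
    rcases le_or_gt t ((2 : ℝ) ^ (-(n : ℝ))) with h | h
    · exact Or.inr ⟨ht.1, h⟩
    · exact Or.inl ⟨h, ht.2.le⟩
  refine (lintegral_mono_set hsub).trans ((lintegral_union_le _ _ _).trans ?_)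
  rw [two_mul]
  refine add_le_add ?_ (h2.trans ?_)
  · refine (lintegral_mono fun t => indicator_le_self' (fun _ _ => zero_le) _).trans
      ((h1 n).trans ?_)
    rw [Finset.sum_range_succ']
    exact le_self_add
  · rw [Finset.sum_range_succ]
    exact le_add_self

lemma rearrangement_one (f : ℝ → ℂ) : rearrangement f 1 = 0 := by
  refine le_antisymm (sInf_le ?_) zero_le
  simpa using prob_le_one (μ := μI)

/-- `2^{-j/2} f^*(2^{-j})`. -/
noncomputable def dyadicSample (f : ℝ → ℂ) (j : ℕ) : ℝ≥0∞ :=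
  ENNReal.ofReal ((2 : ℝ) ^ (-(j : ℝ) / 2)) * rearrangement f ((2 : ℝ) ^ (-(j : ℝ)))

/-- `∑_{j > n} 2^{-(j-n)/2} b_j` for the dyadic samples `b_j` of `f`. -/
noncomputable def dyadicTail (f : ℝ → ℂ) (n : ℕ) : ℝ≥0∞ :=
  ∑' j : ℕ, if n < j then ENNReal.ofReal ((2 : ℝ) ^ (-((j : ℝ) - n) / 2)) * dyadicSample f j
    else 0

lemma lintegral_indicator_above_le {f : ℝ → ℂ} (hf : AEStronglyMeasurable f μI) (n : ℕ) :
    ∫⁻ x, ‖{x | rearrangement f ((2 : ℝ) ^ (-(n : ℝ))) < ‖f x‖ₑ}.indicator f x‖ₑ ∂μI ≤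
      ENNReal.ofReal ((2 : ℝ) ^ (-(n : ℝ) / 2)) * dyadicTail f n := by
  set a := rearrangement f ((2 : ℝ) ^ (-(n : ℝ)))
  have h1 : ∀ x, ‖{x | a < ‖f x‖ₑ}.indicator f x‖ₑ = (Ioi a).indicator id ‖f x‖ₑ := by
    intro x
    by_cases h : a < ‖f x‖ₑ
    · rw [indicator_of_mem (by exact h), indicator_of_mem (by exact h), id]
    · rw [indicator_of_notMem (by exact h), indicator_of_notMem (by exact h), enorm_zero]
  simp_rw [h1]
  rw [lintegral_comp_enorm_eq hf (measurable_id.indicator measurableSet_Ioi)]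
  refine (lintegral_above_le f n).trans (le_of_eq ?_)
  rw [dyadicTail, ← ENNReal.tsum_mul_left]
  refine tsum_congr fun j => ?_
  split_ifs with h
  · rw [dyadicSample, ← mul_assoc, ← mul_assoc, ← ENNReal.ofReal_mul (by positivity),
      ← ENNReal.ofReal_mul (by positivity), ← Real.rpow_add (by norm_num),
      ← Real.rpow_add (by norm_num)]
    congr 3
    ring
  · simp

lemma eLpNorm_indicator_below_le {f : ℝ → ℂ} (hf : AEStronglyMeasurable f μI) (n : ℕ) :
    eLpNorm ({x | rearrangement f ((2 : ℝ) ^ (-(n : ℝ))) < ‖f x‖ₑ}ᶜ.indicator f) 2 μI ≤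
      (2 * ∑ j ∈ Finset.range (n + 1), dyadicSample f j ^ (2 : ℝ)) ^ (1 / 2 : ℝ) := by
  set a := rearrangement f ((2 : ℝ) ^ (-(n : ℝ)))
  have h1 : ∀ x, ‖{x | a < ‖f x‖ₑ}ᶜ.indicator f x‖ₑ ^ (2 : ℝ) =
      (Iic a).indicator (fun x => x ^ (2 : ℝ)) ‖f x‖ₑ := by
    intro x
    by_cases h : a < ‖f x‖ₑ
    · rw [indicator_of_notMem (by simpa using h), indicator_of_notMem (by simpa using h),
        enorm_zero]
      simp
    · rw [indicator_of_mem (by simpa using h), indicator_of_mem (by simpa using h)]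
  rw [eLpNorm_eq_lintegral_rpow_enorm_toReal (by simp) (by simp)]
  simp only [ENNReal.toReal_ofNat]
  simp_rw [h1]
  rw [lintegral_comp_enorm_eq hf ((ENNReal.continuous_rpow_const.measurable).indicator
    measurableSet_Iic)]
  refine ENNReal.rpow_le_rpow ((lintegral_below_le f n).trans (le_of_eq ?_)) (by norm_num)
  congr 1
  refine Finset.sum_congr rfl fun j _ => ?_
  rw [dyadicSample, ENNReal.mul_rpow_of_nonneg _ _ (by norm_num),
    ENNReal.ofReal_rpow_of_nonneg (by positivity) (by norm_num),
    ← Real.rpow_mul (by norm_num)]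
  congr 3
  ring

lemma lintegral_enorm_le_dyadicTail {f : ℝ → ℂ} (hf : AEStronglyMeasurable f μI) :
    ∫⁻ x, ‖f x‖ₑ ∂μI ≤ dyadicTail f 0 := by
  have h := lintegral_indicator_above_le hf 0
  simp only [Nat.cast_zero, neg_zero, Real.rpow_zero, rearrangement_one, zero_div,
    ENNReal.ofReal_one, one_mul] at h
  refine le_trans (le_of_eq (lintegral_congr fun x => ?_)) h
  by_cases hx : 0 < ‖f x‖ₑ
  · rw [indicator_of_mem (by exact hx)]
  · have : f x = 0 := by simpa using hx
    simp [this]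

/-! ### Fourier coefficients -/

section Fourier
variable {ι : Type*} {φ : ι → Lp ℂ 2 μI}

lemma integrable_mul_conj {f : ℝ → ℂ} (hf : Integrable f μI) {M : ℝ} {n : ι}
    (hM : ∀ᵐ x ∂μI, ‖φ n x‖ ≤ M) :
    Integrable (fun x => f x * starRingEnd ℂ (φ n x)) μI := by
  refine hf.mul_bdd (c := M) ?_ ?_
  · exact (RCLike.continuous_conj.comp_aestronglyMeasurable (Lp.aestronglyMeasurable (φ n)))
  · filter_upwards [hM] with x hx
    simpa using hx

lemma enorm_coeffs_le {f : ℝ → ℂ} {M : ℝ} {n : ι}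
    (hM : ∀ᵐ x ∂μI, ‖φ n x‖ ≤ M) :
    ‖coeffs φ f n‖ₑ ≤ ENNReal.ofReal M * ∫⁻ x, ‖f x‖ₑ ∂μI := by
  rw [← lintegral_const_mul' _ _ ENNReal.ofReal_ne_top]
  refine (enorm_integral_le_lintegral_enorm _).trans (lintegral_mono_ae ?_)
  filter_upwards [hM] with x hx
  rw [enorm_mul, mul_comm]
  gcongr
  rw [← ofReal_norm]
  exact ENNReal.ofReal_le_ofReal (by simpa using hx)

lemma sum_enorm_coeffs_sq_le (hφ : Orthonormal ℂ φ) {f : ℝ → ℂ}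
    (hf : AEStronglyMeasurable f μI) (F : Finset ι) :
    ∑ n ∈ F, ‖coeffs φ f n‖ₑ ^ (2 : ℝ) ≤ eLpNorm f 2 μI ^ (2 : ℝ) := by
  rcases eq_or_ne (eLpNorm f 2 μI) ∞ with h | h
  · simp [h]
  have hmem : MemLp f 2 μI := ⟨hf, lt_top_iff_ne_top.2 h⟩
  have hc : ∀ n, coeffs φ f n = inner ℂ (φ n) hmem.toLp := by
    intro n
    rw [L2.inner_def]
    refine integral_congr_ae ?_
    filter_upwards [hmem.coeFn_toLp] with x hx
    rw [hx]
    rfl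
  have hB := hφ.sum_inner_products_le hmem.toLp (s := F)
  have hB' := ENNReal.ofReal_le_ofReal hB
  rw [ENNReal.ofReal_sum_of_nonneg (fun _ _ => by positivity)] at hB'
  simp only [ENNReal.ofReal_pow (norm_nonneg _), ofReal_norm, ← hc] at hB'
  rw [Lp.enorm_toLp] at hB'
  simpa using hB'

lemma partialNorm_coeffs_le (hφ : Orthonormal ℂ φ) {M : ℝ}
    (hM : ∀ n, ∀ᵐ x ∂μI, ‖φ n x‖ ≤ M) {f : ℝ → ℂ} (hf : Integrable f μI) (k n : ℕ) :
    partialNorm (coeffs φ f) k ≤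
      (2 * ∑ j ∈ Finset.range (n + 1), dyadicSample f j ^ (2 : ℝ)) ^ (1 / 2 : ℝ) +
      (k : ℝ≥0∞) ^ (1 / 2 : ℝ) * (ENNReal.ofReal M *
        (ENNReal.ofReal ((2 : ℝ) ^ (-(n : ℝ) / 2)) * dyadicTail f n)) := by
  set A := {x | rearrangement f ((2 : ℝ) ^ (-(n : ℝ))) < ‖f x‖ₑ} with hAdef
  have hA : NullMeasurableSet A μI := nullMeasurableSet_lt aemeasurable_const hf.1.enorm
  have h0 : Integrable (Aᶜ.indicator f) μI := hf.indicator₀ hA.compl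
  have h1 : Integrable (A.indicator f) μI := hf.indicator₀ hA
  have hsplit : ∀ i, coeffs φ f i = coeffs φ (Aᶜ.indicator f) i + coeffs φ (A.indicator f) i := by
    intro i
    unfold coeffs
    rw [← integral_add (integrable_mul_conj h0 (hM i)) (integrable_mul_conj h1 (hM i))]
    refine integral_congr_ae (Filter.Eventually.of_forall fun x => ?_)
    have := congrFun (indicator_compl_add_self A f) x
    simp only [Pi.add_apply] at this
    simp only [← add_mul, this]
  refine (partialNorm_le_add hsplit (fun i => enorm_coeffs_le (hM i)) k).trans ?_
  gcongr
  · exact (partialNorm_le_of_sum_le (sum_enorm_coeffs_sq_le hφ h0.1) k).trans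
      (eLpNorm_indicator_below_le hf.1 n)
  · exact lintegral_indicator_above_le hf.1 n

end Fourier


/-! ### Boundedness of the coefficient map -/

lemma lorentzZygmundNorm_two_dyadicSample_le {q : ℝ≥0∞} (hq : 2 ≤ q) (α : ℝ) :
    ∃ C : ℝ≥0, ∀ f : ℝ → ℂ,
      eLpNorm (fun j : ℕ => ENNReal.ofReal ((1 + j : ℝ) ^ α) * dyadicSample f j) q
        Measure.count ≤ C * lorentzZygmundNorm 2 q α f := by
  obtain ⟨C, hC⟩ := eLpNorm_dyadic_samples_le hq α
  exact ⟨C, fun f => hC _ (rearrangement_antitone f)⟩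

lemma integrable_of_memLorentzZygmund {q : ℝ≥0∞} (hq : 2 ≤ q) {α : ℝ} {f : ℝ → ℂ}
    (hf : MemLorentzZygmund 2 q α f) : Integrable f μI := by
  obtain ⟨C, hC⟩ := lorentzZygmundNorm_two_dyadicSample_le hq α
  obtain ⟨C', hC'⟩ := eLpNorm_tail_le α (le_trans (by norm_num) hq : 1 ≤ q)
  refine ⟨hf.1, (lintegral_enorm_le_dyadicTail hf.1).trans_lt ?_⟩
  have hq0 : q ≠ 0 := (lt_of_lt_of_le (by simp) hq).ne'
  have h := enorm_le_eLpNorm_count (fun n : ℕ => ENNReal.ofReal ((1 + n : ℝ) ^ α) *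
    dyadicTail f n) 0 hq0
  simp only [Nat.cast_zero, add_zero, Real.one_rpow, ENNReal.ofReal_one, one_mul,
    enorm_eq_self] at h
  refine (h.trans ((hC' _).trans (mul_le_mul_right (hC f) _))).trans_lt ?_
  exact ENNReal.mul_lt_top ENNReal.coe_lt_top (ENNReal.mul_lt_top ENNReal.coe_lt_top hf.2)

section Fourier
variable {ι : Type*} {φ : ι → Lp ℂ 2 μI} {M : ℝ}

lemma IsBoundedOrthonormal.ae_norm_le (h : IsBoundedOrthonormal φ M) (hM : 0 ≤ M) (n : ι) :
    ∀ᵐ x ∂μI, ‖φ n x‖ ≤ M := by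
  have h1 : eLpNorm (φ n) ∞ μI ≤ ENNReal.ofReal M :=
    (le_iSup (fun n => eLpNorm (φ n) ∞ μI) n).trans h.2.le
  filter_upwards [enorm_ae_le_eLpNormEssSup (φ n) μI] with x hx
  have h2 := hx.trans h1
  rw [← ofReal_norm] at h2
  exact (ENNReal.ofReal_le_ofReal_iff hM).1 h2

lemma IsBoundedOrthonormal.one_le [Nonempty ι] (h : IsBoundedOrthonormal φ M) : 1 ≤ M := by
  obtain ⟨n⟩ := ‹Nonempty ι›
  rw [← ENNReal.one_le_ofReal]
  have h1 : ‖φ n‖ₑ = 1 := by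
    rw [← ofReal_norm, h.1.1 n, ENNReal.ofReal_one]
  rw [← h1, Lp.enorm_def]
  exact (eLpNorm_le_eLpNorm_of_exponent_le le_top (Lp.aestronglyMeasurable _)).trans
    ((le_iSup (fun n => eLpNorm (φ n) ∞ μI) n).trans h.2.le)

lemma partialNorm_coeffs_dyadic_le (hφ : Orthonormal ℂ φ) (hM0 : 0 ≤ M)
    (hM : ∀ n, ∀ᵐ x ∂μI, ‖φ n x‖ ≤ M) {f : ℝ → ℂ} (hf : Integrable f μI) (m a : ℕ) :
    partialNorm (coeffs φ f) (2 ^ (m + 1)) ≤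
      ENNReal.ofReal (2 * max 1 (M * (2 : ℝ) ^ (-(a : ℝ) / 2))) *
        ((∑ j ∈ Finset.range (m + a + 1), dyadicSample f j ^ (2 : ℝ)) ^ (1 / 2 : ℝ) +
          dyadicTail f (m + a)) := by
  refine (partialNorm_coeffs_le hφ hM hf _ (m + a)).trans ?_
  set l := max 1 (M * (2 : ℝ) ^ (-(a : ℝ) / 2)) with hl
  have hl1 : 1 ≤ l := le_max_left _ _
  rw [mul_add]
  refine add_le_add ?_ ?_
  · rw [ENNReal.mul_rpow_of_nonneg _ _ (by norm_num)]
    gcongr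
    calc (2 : ℝ≥0∞) ^ (1 / 2 : ℝ) ≤ 2 ^ (1 : ℝ) :=
          ENNReal.rpow_le_rpow_of_exponent_le (by norm_num) (by norm_num)
      _ = ENNReal.ofReal 2 := by simp
      _ ≤ _ := ENNReal.ofReal_le_ofReal (by linarith)
  · rw [← mul_assoc, ← mul_assoc]
    gcongr
    have e : ((2 ^ (m + 1) : ℕ) : ℝ≥0∞) ^ (1 / 2 : ℝ) =
        ENNReal.ofReal ((2 : ℝ) ^ (((m : ℝ) + 1) / 2)) := by
      rw [show ((2 ^ (m + 1) : ℕ) : ℝ≥0∞) = ENNReal.ofReal ((2 : ℝ) ^ ((m : ℝ) + 1)) by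
          rw [show (m : ℝ) + 1 = ((m + 1 : ℕ) : ℝ) by push_cast; ring, Real.rpow_natCast,
            ENNReal.ofReal_pow (by norm_num)]
          simp,
        ENNReal.ofReal_rpow_of_nonneg (by positivity) (by norm_num),
        ← Real.rpow_mul (by norm_num)]
      congr 2
      ring
    rw [e, ← ENNReal.ofReal_mul (by positivity), ← ENNReal.ofReal_mul (by positivity)]
    refine ENNReal.ofReal_le_ofReal ?_
    have h1 : (2 : ℝ) ^ (((m : ℝ) + 1) / 2) * (2 : ℝ) ^ (-((m + a : ℕ) : ℝ) / 2) =
        (2 : ℝ) ^ (1 / 2 : ℝ) * (2 : ℝ) ^ (-(a : ℝ) / 2) := by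
      rw [← Real.rpow_add (by norm_num), ← Real.rpow_add (by norm_num)]
      congr 1
      push_cast
      ring
    have h2 : (2 : ℝ) ^ (1 / 2 : ℝ) ≤ 2 := by
      calc (2 : ℝ) ^ (1 / 2 : ℝ) ≤ 2 ^ (1 : ℝ) :=
            Real.rpow_le_rpow_of_exponent_le (by norm_num) (by norm_num)
        _ = 2 := by simp
    calc _ = (2 : ℝ) ^ (1 / 2 : ℝ) * (M * (2 : ℝ) ^ (-(a : ℝ) / 2)) := by
          rw [mul_right_comm, h1]
          ring
      _ ≤ 2 * l := by
          gcongr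
          exact le_max_right _ _

/-- The coefficient bound for a free choice of the level shift `a`. -/
lemma seqLNorm_coeffs_le_shift {q : ℝ≥0∞} {α : ℝ} (hq : 2 ≤ q)
    (hα : α < 1 / 2 - q⁻¹.toReal) :
    ∃ C : ℝ, 0 < C ∧ ∀ (ι : Type) (φ : ι → Lp ℂ 2 μI) (M : ℝ), Orthonormal ℂ φ → 0 ≤ M →
      (∀ n, ∀ᵐ x ∂μI, ‖φ n x‖ ≤ M) → ∀ f : ℝ → ℂ, Integrable f μI → ∀ a : ℕ,
      seqLNorm 2 q (α - 1 / 2) 2 (coeffs φ f) ≤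
        ENNReal.ofReal (C * (max 1 (M * (2 : ℝ) ^ (-(a : ℝ) / 2)) *
          (1 + a : ℝ) ^ |α - 1 / 2|)) * lorentzZygmundNorm 2 q α f := by
  have hq0 : q ≠ 0 := (lt_of_lt_of_le (by simp) hq).ne'
  have hq1 : 1 ≤ q := le_trans (by norm_num) hq
  obtain ⟨C₁, hC₁⟩ := eLpNorm_hardy_sq_le hq hα
  obtain ⟨C₂, hC₂⟩ := eLpNorm_tail_le α hq1
  obtain ⟨C₃, hC₃⟩ := lorentzZygmundNorm_two_dyadicSample_le hq α
  set c₀ : ℝ≥0 := (2 : ℝ≥0) ^ |α - 1 / 2| with hc₀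
  set C : ℝ≥0 := c₀ * 2 * ((C₁ + C₂) * C₃) + 1 with hC
  refine ⟨C, by positivity, fun ι φ M hφ hM0 hM f hf a => ?_⟩
  have hβ : α - 1 / 2 ≤ 0 := by
    have : 0 ≤ q⁻¹.toReal := ENNReal.toReal_nonneg
    linarith
  set l := max 1 (M * (2 : ℝ) ^ (-(a : ℝ) / 2)) with hl
  have hl1 : 1 ≤ l := le_max_left _ _
  set Q : ℕ → ℝ≥0∞ := fun n => ENNReal.ofReal ((1 + n : ℝ) ^ (α - 1 / 2)) *
    (∑ j ∈ Finset.range (n + 1), dyadicSample f j ^ (2 : ℝ)) ^ (1 / 2 : ℝ) with hQ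
  set T : ℕ → ℝ≥0∞ := fun n => ENNReal.ofReal ((1 + n : ℝ) ^ α) * dyadicTail f n with hT
  set B := eLpNorm (fun j : ℕ => ENNReal.ofReal ((1 + j : ℝ) ^ α) * dyadicSample f j) q
    Measure.count with hB
  set d : ℝ≥0 := (2 * l * (1 + a : ℝ) ^ |α - 1 / 2|).toNNReal with hd
  have hpt : ∀ m : ℕ, ENNReal.ofReal ((1 + m : ℝ) ^ (α - 1 / 2)) *
      partialNorm (coeffs φ f) (2 ^ (m + 1)) ≤ d * (Q + T) (m + a) := by
    intro m
    have hm : (0 : ℝ) < 1 + m := by positivity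
    have hma : (0 : ℝ) < 1 + (m + a : ℕ) := by positivity
    have ha : (0 : ℝ) ≤ a := by positivity
    have hm0 : (0 : ℝ) ≤ m := by positivity
    have hw : (1 + m : ℝ) ^ (α - 1 / 2) ≤
        (1 + a : ℝ) ^ |α - 1 / 2| * (1 + (m + a : ℕ) : ℝ) ^ (α - 1 / 2) :=
      rpow_le_rpow_abs_mul _ hm hma (by linarith) (by push_cast; nlinarith)
        (by push_cast; nlinarith)
    have hwT : ENNReal.ofReal ((1 + (m + a : ℕ) : ℝ) ^ (α - 1 / 2)) ≤
        ENNReal.ofReal ((1 + (m + a : ℕ) : ℝ) ^ α) := by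
      refine ENNReal.ofReal_le_ofReal (Real.rpow_le_rpow_of_exponent_le ?_ (by linarith))
      push_cast
      linarith
    calc _ ≤ (ENNReal.ofReal ((1 + a : ℝ) ^ |α - 1 / 2|) *
          ENNReal.ofReal ((1 + (m + a : ℕ) : ℝ) ^ (α - 1 / 2))) *
          (ENNReal.ofReal (2 * l) *
        ((∑ j ∈ Finset.range (m + a + 1), dyadicSample f j ^ (2 : ℝ)) ^ (1 / 2 : ℝ) +
          dyadicTail f (m + a))) := by
          rw [← ENNReal.ofReal_mul (by positivity)]
          gcongr
          exact partialNorm_coeffs_dyadic_le hφ hM0 hM hf m a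
      _ = d * (Q (m + a) + ENNReal.ofReal ((1 + (m + a : ℕ) : ℝ) ^ (α - 1 / 2)) *
          dyadicTail f (m + a)) := by
          have hd' : (d : ℝ≥0∞) = ENNReal.ofReal (2 * l) *
              ENNReal.ofReal ((1 + a : ℝ) ^ |α - 1 / 2|) := by
            rw [hd, ← ENNReal.ofReal, ENNReal.ofReal_mul (by positivity)]
          rw [hd']
          simp only [hQ]
          ring
      _ ≤ _ := by
          simp only [Pi.add_apply, hT]
          gcongr
  have hmeas : ∀ F : ℕ → ℝ≥0∞, AEStronglyMeasurable F Measure.count := fun F =>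
    Measurable.of_discrete.aestronglyMeasurable
  rw [seqLNorm_eq_partialNorm]
  calc _ ≤ (c₀ : ℝ≥0∞) * eLpNorm (fun m : ℕ => ENNReal.ofReal ((1 + m : ℝ) ^ (α - 1 / 2)) *
        partialNorm (coeffs φ f) (2 ^ (m + 1))) q Measure.count :=
        eLpNorm_dyadic_le hq0 _ (partialNorm_mono _)
    _ ≤ c₀ * (d * eLpNorm (fun m => (Q + T) (m + a)) q Measure.count) := by
        gcongr
        exact eLpNorm_le_mul_of_le_mul hpt
    _ ≤ c₀ * (d * (eLpNorm Q q Measure.count + eLpNorm T q Measure.count)) := by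
        gcongr
        exact (eLpNorm_count_comp_add_le q (Q + T) a).trans
          (eLpNorm_add_le (hmeas Q) (hmeas T) hq1)
    _ ≤ c₀ * (d * (C₁ * B + C₂ * B)) := by
        gcongr
        · exact hC₁ _
        · exact hC₂ _
    _ ≤ c₀ * (d * (C₁ * (C₃ * lorentzZygmundNorm 2 q α f) +
          C₂ * (C₃ * lorentzZygmundNorm 2 q α f))) := by
        gcongr
        · exact hC₃ f
        · exact hC₃ f
    _ = ((c₀ * 2 * ((C₁ + C₂) * C₃) : ℝ≥0) : ℝ≥0∞) *
          ENNReal.ofReal (l * (1 + a : ℝ) ^ |α - 1 / 2|) * lorentzZygmundNorm 2 q α f := by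
        rw [hd, ← ENNReal.ofReal, mul_assoc (2 : ℝ), ENNReal.ofReal_mul (by norm_num)]
        push_cast
        simp only [ENNReal.ofReal_ofNat]
        ring
    _ ≤ _ := by
        rw [ENNReal.ofReal_mul (p := (C : ℝ)) (by positivity), ENNReal.ofReal_coe_nnreal]
        gcongr
        rw [hC]
        exact le_self_add

end Fourier

lemma exists_shift_of_one_le {M : ℝ} (hM : 1 ≤ M) :
    ∃ a : ℕ, M * (2 : ℝ) ^ (-(a : ℝ) / 2) ≤ 1 ∧ (1 + a : ℝ) ≤ 3 * (1 + Real.log M) := by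
  have h5 := Real.log_two_gt_d9
  have hM0 : 0 < M := by linarith
  have hlog : 0 ≤ Real.log M := Real.log_nonneg hM
  set x := 2 * Real.log M / Real.log 2 with hx
  have hx0 : 0 ≤ x := by positivity
  have hxl : x * Real.log 2 = 2 * Real.log M := div_mul_cancel₀ _ (by linarith)
  refine ⟨⌈x⌉₊, ?_, ?_⟩
  · have h1 : M ≤ (2 : ℝ) ^ ((⌈x⌉₊ : ℝ) / 2) := by
      rw [← Real.log_le_log_iff hM0 (by positivity), Real.log_rpow (by norm_num)]
      have := Nat.le_ceil x
      nlinarith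
    calc _ ≤ (2 : ℝ) ^ ((⌈x⌉₊ : ℝ) / 2) * (2 : ℝ) ^ (-(⌈x⌉₊ : ℝ) / 2) := by gcongr
      _ = 1 := by
        rw [← Real.rpow_add (by norm_num), neg_div, add_neg_cancel, Real.rpow_zero]
  · have h1 := (Nat.ceil_lt_add_one hx0).le
    have h2 : x ≤ 3 * Real.log M := by nlinarith
    linarith

theorem exists_seqLNorm_coeffs_le {q : ℝ≥0∞} {α : ℝ} (hq : 2 ≤ q)
    (hα : α < 1 / 2 - q⁻¹.toReal) :
    ∃ C : ℝ, 0 < C ∧ ∀ (ι : Type) [Nonempty ι] (φ : ι → Lp ℂ 2 μI) (M : ℝ),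
      IsBoundedOrthonormal φ M → ∀ f : ℝ → ℂ, Integrable f μI →
      seqLNorm 2 q (α - 1 / 2) 2 (coeffs φ f) ≤
        ENNReal.ofReal (C * min M ((1 + Real.log M) ^ |α - 1 / 2|)) *
          lorentzZygmundNorm 2 q α f := by
  obtain ⟨C, hC0, hC⟩ := seqLNorm_coeffs_le_shift hq hα
  have h3 : 1 ≤ (3 : ℝ) ^ |α - 1 / 2| := Real.one_le_rpow (by norm_num) (abs_nonneg _)
  refine ⟨C * 3 ^ |α - 1 / 2|, by positivity, fun ι _ φ M h f hf => ?_⟩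
  have hM1 := h.one_le
  have hM0 : 0 ≤ M := by linarith
  have hlog : 0 ≤ Real.log M := Real.log_nonneg hM1
  have hb := hC ι φ M h.1 hM0 (h.ae_norm_le hM0) f hf
  rcases min_cases M ((1 + Real.log M) ^ |α - 1 / 2|) with ⟨hm, -⟩ | ⟨hm, -⟩
  · rw [hm]
    refine (hb 0).trans ?_
    gcongr ENNReal.ofReal ?_ * _
    simp only [Nat.cast_zero, neg_zero, zero_div, Real.rpow_zero, mul_one, add_zero,
      Real.one_rpow, max_eq_right hM1]
    rw [mul_assoc]
    gcongr
    exact le_mul_of_one_le_left hM0 h3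
  · rw [hm]
    obtain ⟨a, ha1, ha2⟩ := exists_shift_of_one_le hM1
    refine (hb a).trans ?_
    gcongr ENNReal.ofReal ?_ * _
    rw [max_eq_left ha1, one_mul, mul_assoc, ← Real.mul_rpow (by norm_num) (by linarith)]
    gcongr

/-! ### Comparison of the target spaces -/

lemma log_sub_log_le_sum_inv {k n : ℕ} (hk : 1 ≤ k) (hkn : k ≤ n) :
    Real.log n - Real.log k ≤ ∑ j ∈ Finset.Ico k n, (j : ℝ)⁻¹ := by
  induction n, hkn using Nat.le_induction with
  | base => simp
  | succ n hn ih =>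
    rw [Finset.sum_Ico_succ_top hn]
    have hn0 : (0 : ℝ) < n := by exact_mod_cast (by omega : 0 < n)
    have h1 : Real.log ((n + 1 : ℕ) : ℝ) - Real.log n ≤ (n : ℝ)⁻¹ := by
      rw [← Real.log_div (by positivity) hn0.ne']
      refine (Real.log_le_sub_one_of_pos (by positivity)).trans (le_of_eq ?_)
      push_cast
      field_simp
      ring
    linarith

lemma rpow_log_mul_le_eLpNorm {q : ℝ≥0∞} (hq : 1 ≤ q) (hqt : q ≠ ∞) {β : ℝ} (hβ : β ≤ 0)
    {S : ℕ → ℝ≥0∞} (hS : Monotone S) {k : ℕ} (hk : 1 ≤ k) :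
    ENNReal.ofReal ((1 + Real.log k) ^ (q⁻¹.toReal + β)) * S k ≤
      ENNReal.ofReal ((3 : ℝ) ^ (-β)) * eLpNorm (fun j : ℕ =>
        ENNReal.ofReal ((j : ℝ) ^ (-q⁻¹.toReal) * (1 + Real.log j) ^ β) * S j) q
          (Measure.count.restrict (Ici 1)) := by
  have hq0' : q ≠ 0 := (lt_of_lt_of_le (by simp) hq).ne'
  have hq0 : 0 < q.toReal := ENNReal.toReal_pos hq0' hqt
  have hk0 : (0 : ℝ) < k := by exact_mod_cast hk
  have hk1 : (1 : ℝ) ≤ k := by exact_mod_cast hk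
  have hlk : 0 ≤ Real.log k := Real.log_nonneg hk1
  have hL : 0 < 1 + Real.log k := by linarith
  set V : ℝ≥0∞ := ENNReal.ofReal ((3 : ℝ) ^ β * (1 + Real.log k) ^ β) * S k with hV
  have hlog4 : Real.log 4 = 2 * Real.log 2 := by
    rw [show (4 : ℝ) = 2 ^ 2 by norm_num, Real.log_pow]; norm_num
  have h5 := Real.log_two_gt_d9
  have h6 := Real.log_two_lt_d9
  have hlogK : Real.log ((4 * k ^ 2 : ℕ) : ℝ) = Real.log 4 + 2 * Real.log k := by
    push_cast
    rw [Real.log_mul (by norm_num) (by positivity), Real.log_pow]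
    norm_num
  have hpt : ∀ j ∈ Finset.Ico k (4 * k ^ 2), ENNReal.ofReal ((j : ℝ)⁻¹) * V ^ q.toReal ≤
      (ENNReal.ofReal ((j : ℝ) ^ (-q⁻¹.toReal) * (1 + Real.log j) ^ β) * S j) ^ q.toReal := by
    intro j hj
    rw [Finset.mem_Ico] at hj
    have hj0 : (0 : ℝ) < j := by exact_mod_cast (by omega : 0 < j)
    have hlj : 0 ≤ Real.log j := Real.log_nonneg (by exact_mod_cast (by omega : 1 ≤ j))
    have hlj2 : Real.log j ≤ Real.log 4 + 2 * Real.log k := by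
      rw [← hlogK]
      exact Real.log_le_log hj0 (by exact_mod_cast hj.2.le)
    have h1 : (3 : ℝ) ^ β * (1 + Real.log k) ^ β ≤ (1 + Real.log j) ^ β := by
      rw [← Real.mul_rpow (by norm_num) hL.le]
      exact Real.rpow_le_rpow_of_nonpos (by linarith) (by linarith) hβ
    have h2 : ENNReal.ofReal ((j : ℝ)⁻¹) =
        ENNReal.ofReal ((j : ℝ) ^ (-q⁻¹.toReal)) ^ q.toReal := by
      rw [ENNReal.ofReal_rpow_of_nonneg (by positivity) hq0.le, ← Real.rpow_mul hj0.le,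
        ENNReal.toReal_inv, neg_mul, inv_mul_cancel₀ hq0.ne', Real.rpow_neg_one]
    rw [h2, ← ENNReal.mul_rpow_of_nonneg _ _ hq0.le, ENNReal.ofReal_mul (by positivity), mul_assoc]
    refine ENNReal.rpow_le_rpow ?_ hq0.le
    rw [hV]
    gcongr
    exact hS hj.1
  have hint : ENNReal.ofReal (1 + Real.log k) * V ^ q.toReal ≤
      ∫⁻ j in Ici 1, ‖ENNReal.ofReal ((j : ℝ) ^ (-q⁻¹.toReal) * (1 + Real.log j) ^ β) * S j‖ₑ ^
        q.toReal ∂(Measure.count : Measure ℕ) := by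
    have hsub : ((Finset.Ico k (4 * k ^ 2) : Finset ℕ) : Set ℕ) ⊆ Ici 1 := by
      intro j hj
      simp only [Finset.coe_Ico, mem_Ico] at hj
      exact hk.trans hj.1
    refine le_trans ?_ (lintegral_mono_set hsub)
    rw [lintegral_finset]
    simp only [Measure.count_singleton, mul_one, enorm_eq_self]
    refine le_trans ?_ (Finset.sum_le_sum hpt)
    rw [← Finset.sum_mul, ← ENNReal.ofReal_sum_of_nonneg (fun _ _ => by positivity)]
    gcongr
    have hkK : k ≤ 4 * k ^ 2 := by nlinarith
    have := log_sub_log_le_sum_inv hk hkK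
    rw [hlogK] at this
    linarith
  have hnorm : ENNReal.ofReal ((1 + Real.log k) ^ q⁻¹.toReal) * V ≤ eLpNorm (fun j : ℕ =>
        ENNReal.ofReal ((j : ℝ) ^ (-q⁻¹.toReal) * (1 + Real.log j) ^ β) * S j) q
          (Measure.count.restrict (Ici 1)) := by
    rw [eLpNorm_eq_lintegral_rpow_enorm_toReal hq0' hqt]
    refine le_trans (le_of_eq ?_) (ENNReal.rpow_le_rpow hint (by positivity))
    rw [ENNReal.mul_rpow_of_nonneg _ _ (by positivity), ← ENNReal.rpow_mul,
      mul_one_div_cancel hq0.ne', ENNReal.rpow_one,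
      ENNReal.ofReal_rpow_of_nonneg hL.le (by positivity), ENNReal.toReal_inv, one_div]
  refine le_trans (le_of_eq ?_) (mul_le_mul_right hnorm _)
  rw [hV, ← mul_assoc, ← mul_assoc, ← ENNReal.ofReal_mul (by positivity),
    ← ENNReal.ofReal_mul (by positivity)]
  congr 2
  rw [Real.rpow_add hL, Real.rpow_neg (by norm_num)]
  have : (0 : ℝ) < 3 ^ β := by positivity
  field_simp

theorem exists_seqLNorm_top_le {q : ℝ≥0∞} {α : ℝ} (hq : 2 < q) (hα : α < 1 / 2 - q⁻¹.toReal) :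
    ∃ C : ℝ, 0 < C ∧ ∀ (ι : Type) (c : ι → ℂ),
      seqLNorm 2 ∞ (q⁻¹.toReal - 1 / 2 + α) 2 c ≤
        ENNReal.ofReal C * seqLNorm 2 q (α - 1 / 2) 2 c := by
  rcases eq_or_ne q ∞ with rfl | hqt
  · refine ⟨1, one_pos, fun ι c => le_of_eq ?_⟩
    rw [ENNReal.ofReal_one, one_mul]
    congr 1
    simp
    ring
  · have hβ : α - 1 / 2 ≤ 0 := by
      have : 0 ≤ q⁻¹.toReal := ENNReal.toReal_nonneg
      linarith
    refine ⟨3 ^ (-(α - 1 / 2)), by positivity, fun ι c => ?_⟩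
    rw [seqLNorm_eq_partialNorm, seqLNorm_eq_partialNorm, eLpNorm_exponent_top]
    refine essSup_le_of_ae_le _ ((ae_restrict_iff' measurableSet_Ici).2
      (Filter.Eventually.of_forall fun k hk => ?_))
    refine le_trans (le_of_eq ?_) (rpow_log_mul_le_eLpNorm (le_trans (by norm_num) hq.le) hqt hβ
      (partialNorm_mono c) hk)
    simp only [ENNReal.inv_top, ENNReal.toReal_zero, neg_zero, Real.rpow_zero, one_mul,
      enorm_eq_self]
    congr 3
    ring

end LorentzFourier

theorem corollary3p4 :
    -- the general estimate
    (∀ (q : ℝ≥0∞) (α : ℝ), 2 ≤ q → α < 1 / 2 - q⁻¹.toReal →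
      ∃ C : ℝ, 0 < C ∧
        ∀ (ι : Type) [Nonempty ι] (φ : ι → Lp ℂ 2 LorentzFourier.μI) (M : ℝ),
          LorentzFourier.IsBoundedOrthonormal φ M →
          ∀ f : ℝ → ℂ, LorentzFourier.MemLorentzZygmund 2 q α f →
            Integrable f LorentzFourier.μI ∧
            (∀ n, Integrable (fun x => f x * starRingEnd ℂ (φ n x)) LorentzFourier.μI) ∧
            LorentzFourier.seqLNorm 2 q (α - 1 / 2) 2 (LorentzFourier.coeffs φ f) ≤
              ENNReal.ofReal (C * min M ((1 + Real.log M) ^ |α - 1 / 2|)) *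
                LorentzFourier.lorentzZygmundNorm 2 q α f) ∧
    -- the special case of Lorentz spaces
    (∀ q : ℝ≥0∞, 2 < q →
      ∃ C : ℝ, 0 < C ∧
        ∀ (ι : Type) [Nonempty ι] (φ : ι → Lp ℂ 2 LorentzFourier.μI) (M : ℝ),
          LorentzFourier.IsBoundedOrthonormal φ M →
          ∀ f : ℝ → ℂ, LorentzFourier.MemLorentzZygmund 2 q 0 f →
            LorentzFourier.seqLNorm 2 q (-1 / 2) 2 (LorentzFourier.coeffs φ f) ≤
              ENNReal.ofReal (C * (1 + Real.log M) ^ (1 / 2 : ℝ)) *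
                LorentzFourier.lorentzZygmundNorm 2 q 0 f) ∧
    -- the target space is continuously embedded in that of the earlier estimates
    (∀ (q : ℝ≥0∞) (α : ℝ), 2 < q → α < 1 / 2 - q⁻¹.toReal →
      ∃ C : ℝ, 0 < C ∧
        ∀ (ι : Type) (c : ι → ℂ),
          LorentzFourier.seqLNorm 2 ∞ (q⁻¹.toReal - 1 / 2 + α) 2 c ≤
            ENNReal.ofReal C * LorentzFourier.seqLNorm 2 q (α - 1 / 2) 2 c) := by
  refine ⟨fun q α hq hα => ?_, fun q hq => ?_, fun q α hq hα =>
    LorentzFourier.exists_seqLNorm_top_le hq hα⟩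
  · obtain ⟨C, hC0, hC⟩ := LorentzFourier.exists_seqLNorm_coeffs_le hq hα
    refine ⟨C, hC0, fun ι _ φ M h f hf => ?_⟩
    have hint := LorentzFourier.integrable_of_memLorentzZygmund hq hf
    exact ⟨hint, fun n => LorentzFourier.integrable_mul_conj hint
      (h.ae_norm_le (zero_le_one.trans h.one_le) n), hC ι φ M h f hint⟩
  · have hα : (0 : ℝ) < 1 / 2 - q⁻¹.toReal := by
      have h1 : q⁻¹.toReal < (2 : ℝ≥0∞)⁻¹.toReal :=
        ENNReal.toReal_strict_mono (by simp) (ENNReal.inv_lt_inv.2 hq)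
      have h2 : (2 : ℝ≥0∞)⁻¹.toReal = 1 / 2 := by simp
      linarith
    obtain ⟨C, hC0, hC⟩ := LorentzFourier.exists_seqLNorm_coeffs_le hq.le hα
    refine ⟨C, hC0, fun ι _ φ M h f hf => ?_⟩
    have hb := hC ι φ M h f (LorentzFourier.integrable_of_memLorentzZygmund hq.le hf)
    rw [zero_sub, abs_neg, abs_of_pos (by norm_num : (0 : ℝ) < 1 / 2), ← neg_div] at hb
    refine hb.trans ?_
    gcongr
    exact min_le_right _ _
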